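/- Let $W=W_{B_n}$ with $n\ge 2$, or $W=W_{D_n}$ with $n\ge 4$. Let $W$ be given by its standard generators $s_1,\dots,s_n$: in both types $s_i^2=1$, $s_is_{i+1}s_i=s_{i+1}s_is_{i+1}$ ($1\le i\le n-2$), $s_is_j=s_js_i$ ($|i-j|>1$, $i,j\le n-1$); in type $B_n$ moreover $s_is_n=s_ns_i$ ($i\le n-2$) and $(s_{n-1}s_n)^4=1$; in type $D_n$ moreover $s_is_n=s_ns_i$ ($i\ne n-2$) and $s_{n-2}s_ns_{n-2}=s_ns_{n-2}s_n$. The extended affine Weyl group $W^e$ is the group generated by $s_1,\dots,s_n$, subject to these relations, and by $\pi_r$, $r\in O_W^*$, where $O_W^*=\{1\}$ in type $B_n$, $\{1,n\}$ in type $D_n$ with $n$ even, and $\{n\}$ in type $D_n$ with $n$ odd, subject further to: - type $B_n$: $\pi_1^2=1$, $\pi_1s_i=s_i\pi_1$ ($2\le i\le n$), $\pi_1s_1\pi_1s_1=s_1\pi_1s_1\pi_1$; - type $D_n$, $n$ odd: $\pi_n^4=1$, $\pi_n^2s_{n-1}=s_n\pi_n^2$, $\pi_ns_i=s_{n-i}\pi_n$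 ($1\le i\le n-2$), $\pi_ns_n=s_1\pi_n$; - type $D_n$, $n$ even: $\pi_1^2=\pi_n^2=1$, $\pi_1\pi_n=\pi_n\pi_1$, $\pi_1s_1\pi_1=\pi_ns_n\pi_n$, $\pi_1s_i=s_i\pi_1$ and $\pi_ns_i=s_{n-i}\pi_n$ ($2\le i\le n-2$), $\pi_1s_{n-1}=s_n\pi_1$, $\pi_ns_1=s_{n-1}\pi_n$. Let $\mathbb C[\mathfrak h^*]=\mathbb C[x_1,\dots,x_n]$, and let $\mathcal C_n$ be the Clifford algebra of $\mathbb C^n$ with its standard form, with generators $c_1,\dots,c_n$ satisfying $c_i^2=1$, $c_ic_j=-c_jc_i$ ($i\ne j$). Define linear maps $\sigma_r$ of $\mathbb C^n$ with standard basis $e_1,\dots,e_n$ as follows. In type $B_n$: $\sigma_1e_1=-e_1$ and $\sigma_1e_i=e_i$ for $i\ne1$. In type $D_n$: $\sigma_1e_i=-e_i$ for $i\in\{1,n\}$ and $\sigma_1e_i=e_i$ otherwise; $\sigma_ne_i=-e_{n+1-i}$ for $i\neq n$ and $\sigma_ne_n=(-1)^{n-1}e_1$. If $\sigma_re_i=\pm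 e_j$, write $x_i^{\sigma_r}=\pm x_j$ and $c_i^{\sigma_r}=\pm c_j$. For $u,v\in\mathbb C$ ($v$ only in type $B_n$), the trigonometric double affine Hecke–Clifford algebra $\ddot H^{\mathfrak c}_W$ is the associative unital $\mathbb C$-algebra generated by $s_i,x_i,c_i$ ($1\le i\le n$) and $\pi_r^{\pm1}$ ($r\in O_W^*$), subject to the above relations of $W^e$, the above relations of the $c_i$, and - $x_ix_j=x_jx_i$, $x_ic_i=-c_ix_i$, $x_ic_j=c_jx_i$ ($i\neq j$); - for $1\le i\le n-1$: $s_ic_k=c_{s_i(k)}s_i$ for all $k$, where $s_i$ acts on indices as the transposition $(i\;i+1)$; $x_{i+1}s_i-s_ix_i=u(1-c_{i+1}c_i)$; $x_js_i=s_ix_j$ ($j\ne i,i+1$); - type $B_n$: $s_nc_n=-c_ns_n$, $s_nc_i=c_is_n$ ($i\neq n$), $s_nx_n=-x_ns_n-\sqrt2\,v$, $s_nx_i=x_is_n$ ($i\ne n$); - type $D_n$: $s_nc_n=-c_{n-1}s_n$, $s_nc_i=c_is_n$ ($i\ne n-1,n$), $s_nx_n=-x_{n-1}s_n-u(1+c_{n-1}c_n)$,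 $s_nx_i=x_is_n$ ($i\ne n-1,n$); - $\pi_rx_i=x_i^{\sigma_r}\pi_r$ and $\pi_rc_i=c_i^{\sigma_r}\pi_r$ for $r\in O_W^*$, $1\le i\le n$. **Theorem.** For all $u,v\in\mathbb C$, the elements $$x^\alpha c^\beta w=x_1^{\alpha_1}\cdots x_n^{\alpha_n}\,c_1^{\beta_1}\cdots c_n^{\beta_n}\,w\qquad(\alpha\in\mathbb Z_{\ge0}^n,\ \beta\in\mathbb Z_2^n,\ w\in W^e)$$ form a $\mathbb C$-linear basis of $\ddot H^{\mathfrak c}_W$ (here $w$ denotes also its image in $\ddot H^{\mathfrak c}_W$, and the entries of $\beta$ are read as exponents $0$ or $1$). Equivalently, multiplication induces an isomorphism of vector spaces $$\mathbb C[\mathfrak h^*]\otimes\mathcal C_n\otimes\mathbb CW^e\ \stackrel{\simeq}{\longrightarrow}\ \ddot H^{\mathfrak c}_W,\qquad f\otimes c\otimes w\mapsto f\,c\,w .$$ -/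

import Mathlib

open scoped TensorProduct

noncomputable section

namespace DAHCa

/-- The two families of finite Weyl groups considered here: `W_{B_n}` and `W_{D_n}`. -/
inductive WeylType
  | B
  | D

/-- The two possible subscripts `r` of a generator `π_r`: `first` is `r = 1`, `last` is `r = n`. -/
inductive PiIdx
  | first
  | last

/-- The set `O_W^*` of subscripts of the generators `π_r`: it is `{1}` in type `B_n`,
`{1, n}` in type `D_n` with `n` even and `{n}` in type `D_n` with `n` odd. -/
def OStar : WeylType → ℕ → Set PiIdx
  | .B, _ => {.first}
  | .D, n => {r | r = .last ∨ Even n}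

/-- The label in `{1, …, n}` of an element of `Fin n`. -/
def lab {n : ℕ} (i : Fin n) : ℕ := i.val + 1

/-- Generators `s_1, …, s_n` and `π_r` (`r ∈ O_W^*`) of the extended affine Weyl group. -/
inductive GroupGen (X : WeylType) (n : ℕ)
  | s (i : Fin n)
  | pi (r : OStar X n)

/-- The generator `s_i` as a word. -/
def ws {X : WeylType} {n : ℕ} (i : Fin n) : FreeMonoid (GroupGen X n) := FreeMonoid.of (.s i)

/-- The generator `π_r` as a word. -/
def wp {X : WeylType} {n : ℕ} (r : OStar X n) : FreeMonoid (GroupGen X n) := FreeMonoid.of (.pi r)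

/-- The defining relations of the extended affine Weyl group `W^e`: those among the `s_i` present
the finite Weyl group `W`, the others involve the `π_r`. -/
inductive GroupRel (n : ℕ) :
    (X : WeylType) → FreeMonoid (GroupGen X n) → FreeMonoid (GroupGen X n) → Prop
  -- the finite Weyl group: relations common to both types
  | invol (X : WeylType) (i : Fin n) : GroupRel n X (ws i * ws i) 1
  | braid (X : WeylType) (i j : Fin n) (hij : lab j = lab i + 1) (hj : lab j < n) :
      GroupRel n X (ws i * ws j * ws i) (ws j * ws i * ws j)
  | comm (X : WeylType) (i j : Fin n) (hij : lab i + 1 < lab j) (hj : lab j < n) :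
      GroupRel n X (ws i * ws j) (ws j * ws i)
  -- the finite Weyl group of type B: relations with `s_n`
  | comm_last_B (i k : Fin n) (hi : lab i + 2 ≤ n) (hk : lab k = n) :
      GroupRel n .B (ws i * ws k) (ws k * ws i)
  | braid_last_B (m k : Fin n) (hm : lab m + 1 = n) (hk : lab k = n) :
      GroupRel n .B ((ws m * ws k) ^ 4) 1
  -- the finite Weyl group of type D: relations with `s_n`
  | comm_last_D (i k : Fin n) (hi : lab i + 2 ≠ n) (hk : lab k = n) :
      GroupRel n .D (ws i * ws k) (ws k * ws i)
  | braid_last_D (l k : Fin n) (hl : lab l + 2 = n) (hk : lab k = n) :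
      GroupRel n .D (ws l * ws k * ws l) (ws k * ws l * ws k)
  -- type B: relations with `π_1`
  | pi_sq_B (p : OStar .B n) : GroupRel n .B (wp p ^ 2) 1
  | pi_s_B (p : OStar .B n) (i : Fin n) (hi : 2 ≤ lab i) :
      GroupRel n .B (wp p * ws i) (ws i * wp p)
  | pi_s_one_B (p : OStar .B n) (i : Fin n) (hi : lab i = 1) :
      GroupRel n .B (wp p * ws i * wp p * ws i) (ws i * wp p * ws i * wp p)
  -- type D, `n` odd: relations with `q = π_n`
  | pi_four_D (hn : Odd n) (q : OStar .D n) (hq : q.1 = .last) : GroupRel n .D (wp q ^ 4) 1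
  | pi_sq_s_D (hn : Odd n) (q : OStar .D n) (hq : q.1 = .last) (m k : Fin n)
      (hm : lab m + 1 = n) (hk : lab k = n) :
      GroupRel n .D (wp q ^ 2 * ws m) (ws k * wp q ^ 2)
  | pi_s_D (hn : Odd n) (q : OStar .D n) (hq : q.1 = .last) (i j : Fin n)
      (hi : lab i + 2 ≤ n) (hj : lab i + lab j = n) :
      GroupRel n .D (wp q * ws i) (ws j * wp q)
  | pi_s_last_D (hn : Odd n) (q : OStar .D n) (hq : q.1 = .last) (i k : Fin n)
      (hi : lab i = 1) (hk : lab k = n) :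
      GroupRel n .D (wp q * ws k) (ws i * wp q)
  -- type D, `n` even: relations with `p = π_1` and `q = π_n`
  | pi_sq_D (hn : Even n) (p : OStar .D n) : GroupRel n .D (wp p ^ 2) 1
  | pi_comm_D (hn : Even n) (p q : OStar .D n) (hp : p.1 = .first) (hq : q.1 = .last) :
      GroupRel n .D (wp p * wp q) (wp q * wp p)
  | pi_conj_D (hn : Even n) (p q : OStar .D n) (hp : p.1 = .first) (hq : q.1 = .last)
      (i k : Fin n) (hi : lab i = 1) (hk : lab k = n) :
      GroupRel n .D (wp p * ws i * wp p) (wp q * ws k * wp q)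
  | pi_one_s_D (hn : Even n) (p : OStar .D n) (hp : p.1 = .first) (i : Fin n)
      (hi : 2 ≤ lab i) (hi' : lab i + 2 ≤ n) :
      GroupRel n .D (wp p * ws i) (ws i * wp p)
  | pi_last_s_D (hn : Even n) (q : OStar .D n) (hq : q.1 = .last) (i j : Fin n)
      (hi : 2 ≤ lab i) (hi' : lab i + 2 ≤ n) (hj : lab i + lab j = n) :
      GroupRel n .D (wp q * ws i) (ws j * wp q)
  | pi_one_swap_D (hn : Even n) (p : OStar .D n) (hp : p.1 = .first) (m k : Fin n)
      (hm : lab m + 1 = n) (hk : lab k = n) :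
      GroupRel n .D (wp p * ws m) (ws k * wp p)
  | pi_last_swap_D (hn : Even n) (q : OStar .D n) (hq : q.1 = .last) (i m : Fin n)
      (hi : lab i = 1) (hm : lab m + 1 = n) :
      GroupRel n .D (wp q * ws i) (ws m * wp q)

/-- A positive word as an element of the free group. -/
def toFreeGroup (X : WeylType) (n : ℕ) : FreeMonoid (GroupGen X n) →* FreeGroup (GroupGen X n) :=
  FreeMonoid.lift FreeGroup.of

/-- The relators `a b⁻¹` attached to the defining relations `a = b` of `W^e`. -/
def relators (X : WeylType) (n : ℕ) : Set (FreeGroup (GroupGen X n)) :=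
  {w | ∃ a b, GroupRel n X a b ∧ w = toFreeGroup X n a * (toFreeGroup X n b)⁻¹}

/-- The extended affine Weyl group `W^e`. -/
abbrev We (X : WeylType) (n : ℕ) : Type := PresentedGroup (relators X n)

/-- The element `σ_r` of `W` acts on the standard orthonormal basis by
`σ_r e_i = (sigmaSign r i) e_{sigmaIdx r i}`. -/
def sigmaIdx {n : ℕ} : PiIdx → Fin n → Fin n
  | .first, i => i
  | .last, i => i.rev

/-- The sign in `σ_r e_i = ± e_j`: in type `B` one has `σ_1 e_1 = -e_1` and `σ_1 e_i = e_i` for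
`i ≠ 1`; in type `D` one has `σ_1 e_i = -e_i` for `i = 1, n` and `σ_1 e_i = e_i` for the other `i`,
and `σ_n e_i = -e_{n+1-i}` for `i ≠ n` and `σ_n e_n = (-1)^{n-1} e_1`.
(There is no `π_n` in type `B`; the value there is not used.) -/
def sigmaSign {n : ℕ} : WeylType → PiIdx → Fin n → ℂ
  | .B, _, i => if lab i = 1 then -1 else 1
  | .D, .first, i => if lab i = 1 ∨ lab i = n then -1 else 1
  | .D, .last, i => if lab i = n then (-1) ^ (n - 1) else -1

/-- Generators `s_i`, `π_r^{±1}`, `x_i`, `c_i` of the trigonometric double affine Hecke-Clifford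
algebra. -/
inductive Gen (X : WeylType) (n : ℕ)
  | s (i : Fin n)
  | pi (r : OStar X n)
  | piInv (r : OStar X n)
  | x (i : Fin n)
  | c (i : Fin n)

/-- The free algebra on the generators. -/
abbrev Fr (X : WeylType) (n : ℕ) : Type := FreeAlgebra ℂ (Gen X n)

namespace Fr

variable {X : WeylType} {n : ℕ}

def s (i : Fin n) : Fr X n := FreeAlgebra.ι ℂ (.s i)
def pi (r : OStar X n) : Fr X n := FreeAlgebra.ι ℂ (.pi r)
def piInv (r : OStar X n) : Fr X n := FreeAlgebra.ι ℂ (.piInv r)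
def x (i : Fin n) : Fr X n := FreeAlgebra.ι ℂ (.x i)
def c (i : Fin n) : Fr X n := FreeAlgebra.ι ℂ (.c i)

/-- A positive word in the `s_i` and `π_r` as an element of the free algebra. -/
def word : FreeMonoid (GroupGen X n) →* Fr X n :=
  FreeMonoid.lift fun g => match g with
    | .s i => s i
    | .pi r => pi r

end Fr

open Fr in
/-- The defining relations of the trigonometric double affine Hecke-Clifford algebra of type `X_n`
with parameters `u`, `v` (the parameter `v` occurs in type `B` only). -/
inductive AlgRel (n : ℕ) (u v : ℂ) : (X : WeylType) → Fr X n → Fr X n → Prop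
  -- the relations of the extended affine Weyl group
  | group (X : WeylType) (a b : FreeMonoid (GroupGen X n)) (h : GroupRel n X a b) :
      AlgRel n u v X (word a) (word b)
  | pi_piInv (X : WeylType) (r : OStar X n) : AlgRel n u v X (pi r * piInv r) 1
  | piInv_pi (X : WeylType) (r : OStar X n) : AlgRel n u v X (piInv r * pi r) 1
  -- polynomial and Clifford generators
  | x_comm (X : WeylType) (i j : Fin n) : AlgRel n u v X (x i * x j) (x j * x i)
  | c_sq (X : WeylType) (i : Fin n) : AlgRel n u v X (c i * c i) 1
  | c_anti (X : WeylType) (i j : Fin n) (hij : i ≠ j) : AlgRel n u v X (c i * c j) (-(c j * c i))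
  | x_c_same (X : WeylType) (i : Fin n) : AlgRel n u v X (x i * c i) (-(c i * x i))
  | x_c (X : WeylType) (i j : Fin n) (hij : i ≠ j) : AlgRel n u v X (x i * c j) (c j * x i)
  -- the simple transpositions `s_i`, `i ≤ n - 1` (here `j = i + 1`)
  | s_c (X : WeylType) (i j : Fin n) (hij : lab j = lab i + 1) (k : Fin n) :
      AlgRel n u v X (s i * c k) (c (Equiv.swap i j k) * s i)
  | x_s (X : WeylType) (i j : Fin n) (hij : lab j = lab i + 1) :
      AlgRel n u v X (x j * s i - s i * x i) (u • (1 - c j * c i))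
  | x_s_other (X : WeylType) (i j : Fin n) (hij : lab j = lab i + 1) (k : Fin n)
      (hki : k ≠ i) (hkj : k ≠ j) :
      AlgRel n u v X (x k * s i) (s i * x k)
  -- the reflection `s_n` in type B (here `k = n`)
  | sn_cn_B (k : Fin n) (hk : lab k = n) : AlgRel n u v .B (s k * c k) (-(c k * s k))
  | sn_c_B (i k : Fin n) (hk : lab k = n) (hi : i ≠ k) :
      AlgRel n u v .B (s k * c i) (c i * s k)
  | sn_xn_B (k : Fin n) (hk : lab k = n) :
      AlgRel n u v .B (s k * x k) (-(x k * s k) - algebraMap ℂ _ ((Real.sqrt 2 : ℂ) * v))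
  | sn_x_B (i k : Fin n) (hk : lab k = n) (hi : i ≠ k) :
      AlgRel n u v .B (s k * x i) (x i * s k)
  -- the reflection `s_n` in type D (here `m = n - 1`, `k = n`)
  | sn_cn_D (m k : Fin n) (hm : lab m + 1 = n) (hk : lab k = n) :
      AlgRel n u v .D (s k * c k) (-(c m * s k))
  | sn_c_D (i m k : Fin n) (hm : lab m + 1 = n) (hk : lab k = n) (him : i ≠ m) (hik : i ≠ k) :
      AlgRel n u v .D (s k * c i) (c i * s k)
  | sn_xn_D (m k : Fin n) (hm : lab m + 1 = n) (hk : lab k = n) :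
      AlgRel n u v .D (s k * x k) (-(x m * s k) - u • (1 + c m * c k))
  | sn_x_D (i m k : Fin n) (hm : lab m + 1 = n) (hk : lab k = n) (him : i ≠ m) (hik : i ≠ k) :
      AlgRel n u v .D (s k * x i) (x i * s k)
  -- the generators `π_r`
  | pi_x (X : WeylType) (r : OStar X n) (i : Fin n) :
      AlgRel n u v X (pi r * x i) (sigmaSign X r.1 i • x (sigmaIdx r.1 i) * pi r)
  | pi_c (X : WeylType) (r : OStar X n) (i : Fin n) :
      AlgRel n u v X (pi r * c i) (sigmaSign X r.1 i • c (sigmaIdx r.1 i) * pi r)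

/-- The trigonometric double affine Hecke-Clifford algebra of type `X_n` with parameters `u, v`. -/
abbrev H (X : WeylType) (n : ℕ) (u v : ℂ) : Type := RingQuot (AlgRel n u v X)

namespace H

variable (X : WeylType) (n : ℕ) (u v : ℂ)

/-- The quotient map from the free algebra. -/
def mk : Fr X n →ₐ[ℂ] H X n u v := RingQuot.mkAlgHom ℂ (AlgRel n u v X)

variable {X n u v} in
theorem mk_rel {a b : Fr X n} (h : AlgRel n u v X a b) : mk X n u v a = mk X n u v b :=
  RingQuot.mkAlgHom_rel ℂ h

/-- The generator `x_i`. -/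
def x (i : Fin n) : H X n u v := mk X n u v (Fr.x i)

/-- The generator `c_i`. -/
def c (i : Fin n) : H X n u v := mk X n u v (Fr.c i)

/-- The generators `s_i` and `π_r` as units. -/
def unitOf : GroupGen X n → (H X n u v)ˣ
  | .s i =>
    have h : mk X n u v (Fr.s i) * mk X n u v (Fr.s i) = 1 := by
      simpa [Fr.word, ws] using mk_rel (AlgRel.group (u := u) (v := v) X _ _ (GroupRel.invol X i))
    ⟨mk X n u v (Fr.s i), mk X n u v (Fr.s i), h, h⟩
  | .pi r =>
    ⟨mk X n u v (Fr.pi r), mk X n u v (Fr.piInv r),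
      by simpa using mk_rel (AlgRel.pi_piInv (u := u) (v := v) X r),
      by simpa using mk_rel (AlgRel.piInv_pi (u := u) (v := v) X r)⟩

theorem lift_unitOf (a : FreeMonoid (GroupGen X n)) :
    ((FreeGroup.lift (unitOf X n u v) (toFreeGroup X n a) : (H X n u v)ˣ) : H X n u v)
      = mk X n u v (Fr.word a) := by
  have : (Units.coeHom (H X n u v)).comp
      ((FreeGroup.lift (unitOf X n u v)).comp (toFreeGroup X n))
      = ((mk X n u v : Fr X n →* H X n u v)).comp Fr.word := by
    refine FreeMonoid.hom_eq fun g => ?_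
    cases g <;> simp [toFreeGroup, Fr.word, unitOf]
  exact DFunLike.congr_fun this a

/-- The group homomorphism from `W^e` to the units of the algebra with `s_i ↦ s_i`, `π_r ↦ π_r`. -/
def weUnits : We X n →* (H X n u v)ˣ :=
  PresentedGroup.toGroup (f := unitOf X n u v) (by
    rintro _ ⟨a, b, hab, rfl⟩
    rw [map_mul, map_inv, mul_inv_eq_one]
    ext
    rw [lift_unitOf, lift_unitOf]
    exact mk_rel (AlgRel.group X a b hab))

/-- The multiplicative map `W^e → H`, `w ↦ w`. -/
def we : We X n →* H X n u v := (Units.coeHom _).comp (weUnits X n u v)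

theorem x_comm (i j : Fin n) : Commute (x X n u v i) (x X n u v j) := by
  have := mk_rel (AlgRel.x_comm (u := u) (v := v) X i j)
  simpa [Commute, SemiconjBy, x] using this

theorem c_sq (i : Fin n) : c X n u v i * c X n u v i = 1 := by
  simpa [c] using mk_rel (AlgRel.c_sq (u := u) (v := v) X i)

theorem c_anti (i j : Fin n) (h : i ≠ j) :
    c X n u v i * c X n u v j = -(c X n u v j * c X n u v i) := by
  simpa [c] using mk_rel (AlgRel.c_anti (u := u) (v := v) X i j h)

/-- The monomial `x^α = x_1^{α_1} ⋯ x_n^{α_n}`. -/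
def xPow (α : Fin n → ℕ) : H X n u v := (List.ofFn fun i => x X n u v i ^ α i).prod

/-- The monomial `c^β = c_1^{β_1} ⋯ c_n^{β_n}`, with the exponents taken in `{0, 1}`. -/
def cPow (β : Fin n → ZMod 2) : H X n u v := (List.ofFn fun i => c X n u v i ^ (β i).val).prod

theorem prod_ofFn_pow_add {M : Type*} [Monoid M] :
    ∀ {k : ℕ} (y : Fin k → M) (_ : ∀ i j, Commute (y i) (y j)) (α β : Fin k → ℕ),
      (List.ofFn fun i => y i ^ (α i + β i)).prod
        = (List.ofFn fun i => y i ^ α i).prod * (List.ofFn fun i => y i ^ β i).prod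
  | 0, _, _, _, _ => by simp
  | k + 1, y, hy, α, β => by
    have ih := prod_ofFn_pow_add (fun i : Fin k => y i.succ) (fun i j => hy _ _)
      (fun i => α i.succ) (fun i => β i.succ)
    have hc : Commute (y 0 ^ β 0) (List.ofFn fun i : Fin k => y i.succ ^ α i.succ).prod := by
      refine Commute.list_prod_right _ _ fun z hz => ?_
      obtain ⟨i, rfl⟩ := List.mem_ofFn.1 hz
      exact (hy _ _).pow_pow _ _
    simp only [List.ofFn_succ, List.prod_cons]
    rw [ih, pow_add]
    simp only [mul_assoc]
    rw [← mul_assoc (y 0 ^ β 0), hc.eq]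
    simp only [mul_assoc]

/-- The exponent map `α ↦ x^α` as a monoid homomorphism. -/
def xPowHom : Multiplicative (Fin n →₀ ℕ) →* H X n u v where
  toFun α := xPow X n u v ⇑(Multiplicative.toAdd α : Fin n →₀ ℕ)
  map_one' := by
    have : (List.ofFn fun _ : Fin n => (1 : H X n u v)).prod = 1 :=
      List.prod_eq_one fun z hz => by
        obtain ⟨i, rfl⟩ := List.mem_ofFn.1 hz; rfl
    simpa only [xPow, toAdd_one, Finsupp.coe_zero, Pi.zero_apply, pow_zero] using this
  map_mul' α β := by
    simpa [xPow] using
      prod_ofFn_pow_add (x X n u v) (x_comm X n u v)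
        ⇑(Multiplicative.toAdd α : Fin n →₀ ℕ) ⇑(Multiplicative.toAdd β : Fin n →₀ ℕ)

/-- The algebra homomorphism `ℂ[𝔥*] → H` with `x_i ↦ x_i`, where `ℂ[𝔥*] = ℂ[x_1, …, x_n]`. -/
def polyHom : MvPolynomial (Fin n) ℂ →ₐ[ℂ] H X n u v :=
  AddMonoidAlgebra.lift ℂ (H X n u v) (Fin n →₀ ℕ) (xPowHom X n u v)

end H

/-- The standard quadratic form `∑ i, z_i ^ 2` on `ℂ^n`. -/
abbrev stdForm (n : ℕ) : QuadraticForm ℂ (Fin n → ℂ) :=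
  QuadraticMap.weightedSumSquares ℂ (fun _ : Fin n => (1 : ℂ))

/-- The Clifford algebra `𝒞_n`: its generators `c_i`, the images of the standard basis vectors,
satisfy `c_i ^ 2 = 1` and `c_i c_j = - c_j c_i` for `i ≠ j`. -/
abbrev Cl (n : ℕ) : Type := CliffordAlgebra (stdForm n)

namespace H

variable (X : WeylType) (n : ℕ) (u v : ℂ)

/-- The linear map `z ↦ ∑ i, z_i c_i`. -/
def cLin : (Fin n → ℂ) →ₗ[ℂ] H X n u v := Fintype.linearCombination ℂ (c X n u v)

theorem cLin_sq (z : Fin n → ℂ) :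
    cLin X n u v z * cLin X n u v z = algebraMap ℂ _ (stdForm n z) := by
  set S := cLin X n u v z * cLin X n u v z with hS
  have e1 : S = ∑ i, ∑ j, (z i * z j) • (c X n u v i * c X n u v j) := by
    simp only [hS, cLin, Fintype.linearCombination_apply, Finset.sum_mul_sum, smul_mul_smul_comm]
  have e2 : S = ∑ i, ∑ j, (z i * z j) • (c X n u v j * c X n u v i) := by
    rw [e1, Finset.sum_comm]
    simp only [mul_comm]
  have e3 : (2 : ℂ) • S = (2 : ℂ) • algebraMap ℂ (H X n u v) (stdForm n z) := by
    rw [two_smul]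
    nth_rewrite 1 [e1]
    rw [e2, ← Finset.sum_add_distrib]
    have : ∀ i, (∑ j, (z i * z j) • (c X n u v i * c X n u v j))
        + ∑ j, (z i * z j) • (c X n u v j * c X n u v i)
        = (2 * (z i * z i)) • (1 : H X n u v) := by
      intro i
      rw [← Finset.sum_add_distrib, Finset.sum_eq_single i]
      · rw [c_sq, ← add_smul, two_mul]
      · intro j _ hj
        rw [c_anti X n u v i j hj.symm]
        simp
      · simp
    simp only [this]
    rw [← Finset.sum_smul, ← Finset.mul_sum, mul_smul, Algebra.algebraMap_eq_smul_one]
    congr 2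
    simp [QuadraticMap.weightedSumSquares_apply]
  exact smul_right_injective _ (two_ne_zero (α := ℂ)) e3

/-- The algebra homomorphism `𝒞_n → H` with `c_i ↦ c_i`. -/
def cliffHom : Cl n →ₐ[ℂ] H X n u v :=
  CliffordAlgebra.lift (stdForm n) ⟨cLin X n u v, cLin_sq X n u v⟩

/-- The algebra homomorphism `ℂ W^e → H` with `s_i ↦ s_i`, `π_r ↦ π_r`. -/
def weHom : MonoidAlgebra ℂ (We X n) →ₐ[ℂ] H X n u v :=
  MonoidAlgebra.lift ℂ (H X n u v) (We X n) (we X n u v)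

/-- The linear map `ℂ[𝔥*] ⊗ 𝒞_n ⊗ ℂ W^e → H`, `f ⊗ c ⊗ w ↦ f c w`. -/
def mulMap :
    (MvPolynomial (Fin n) ℂ ⊗[ℂ] Cl n) ⊗[ℂ] MonoidAlgebra ℂ (We X n) →ₗ[ℂ] H X n u v :=
  LinearMap.mul' ℂ (H X n u v) ∘ₗ
    TensorProduct.map
      (LinearMap.mul' ℂ (H X n u v) ∘ₗ
        TensorProduct.map (polyHom X n u v).toLinearMap (cliffHom X n u v).toLinearMap)
      (weHom X n u v).toLinearMap

/-- The element `x^α c^β w` of the algebra attached to `(α, β, w)`. -/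
def pbw (t : (Fin n → ℕ) × (Fin n → ZMod 2) × We X n) : H X n u v :=
  xPow X n u v t.1 * cPow X n u v t.2.1 * we X n u v t.2.2

end H

/-- The PBW property: the elements `x^α c^β w` form a `ℂ`-basis of the algebra, and multiplication
is a linear isomorphism `ℂ[𝔥*] ⊗ 𝒞_n ⊗ ℂ W^e ≃ H`. -/
def PBWProperty (X : WeylType) (n : ℕ) (u v : ℂ) : Prop :=
  (LinearIndependent ℂ (H.pbw X n u v) ∧
    Submodule.span ℂ (Set.range (H.pbw X n u v)) = ⊤) ∧
  Function.Bijective (H.mulMap X n u v)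

end DAHCa

end

/-!
The standard monomials are independent because the algebra acts on the space they are expected to
form, and they span because every generator can be moved to the right of the polynomial and
Clifford generators.

Let `A = ℂ[x_1, …, x_n] ⋊ 𝒞_n` be the algebra `PC n` presented by the relations among the `x_i` and
`c_i` alone. It acts on the space with basis the exponents `(α, β)`, where `x^α c^β` sends
the vector `(0, 0)` to a multiple of `(α, β)`, so that the `x^α c^β` form a basis of `A`
(`PC.linearIndependent_mono`, `PC.span_mono`).

In the double affine algebra a generator `g` of the extended affine Weyl group satisfies
`g a = φ(a) g + D(a)` for `a ∈ A`, where `φ` is an automorphism of `A` and `D` is a twisted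
derivation, `D (a b) = D(a) b + φ(a) D(b)`. Such a `D` with prescribed values on the generators is
the same thing as a homomorphism `A → M₂(A)` with values in triangular matrices of diagonal `(φ, id)`,
so that its existence is checked on the relations of `A` (`Twist.ofLetters`). The induced module
`A ⊗ ℂ W^e` then carries the operators `b ⊗ w ↦ φ(b) ⊗ g w + D(b) ⊗ w` (`Ind.op`).

The point is that these operators satisfy the relations of `W^e`. Two words representing the same
element of `W^e` agree on all `1 ⊗ w`, since `D(1) = 0`. Hence their difference vanishes as soon as
it can be moved past every generator of `A`, changing only that generator (`Ind.eq_of_slidesAll`),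
that is, as soon as the two words, moved past a generator, produce the same correction terms.
This is a computation in rank two: the braid relations of types `A_2` and `B_2`
(`IsRefl.braid_slides`, `IsRefl.braid_four_slides`), the commutation of the reflections
in `e_{n-1} ∓ e_n` (`IsRefl.comm_neg_slides`), and the compatibility of the correction terms with
the signed permutations `σ_r` (`IsRefl.intertwine_slides`). Applied to `1 ⊗ 1` the element
`x^α c^β w` gives `x^α c^β ⊗ w`, which proves independence (`linearIndependent_pbw`).

The span of the `x^α c^β w` is stable under left multiplication by the generators (`span_pbw`).
Finally the multiplication map sends a spanning family of tensors to the basis just found, and is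
therefore bijective (`pbwProperty`).
-/

noncomputable section

namespace DAHCa

/-! ### Monomials in commuting and anticommuting elements -/

section OrdMono

variable {R : Type*} [Monoid R] {n : ℕ}

/-- The ordered monomial `x_1^{α_1} ⋯ x_n^{α_n}`; the factors need not commute. -/
def ordMono (x : Fin n → R) (α : Fin n → ℕ) : R := (List.ofFn fun i => x i ^ α i).prod

theorem ordMono_eq_map (x : Fin n → R) (α : Fin n → ℕ) :
    ordMono x α = ((List.finRange n).map fun i => x i ^ α i).prod := by
  rw [ordMono, List.ofFn_eq_map]

theorem ordMono_zero (x : Fin n → R) : ordMono x 0 = 1 := by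
  rw [ordMono_eq_map]
  exact List.prod_eq_one fun z hz => by
    obtain ⟨i, -, rfl⟩ := List.mem_map.1 hz; simp

theorem map_ordMono {S F : Type*} [Monoid S] [FunLike F R S] [MonoidHomClass F R S] (f : F)
    (x : Fin n → R) (α : Fin n → ℕ) : f (ordMono x α) = ordMono (fun i => f (x i)) α := by
  rw [ordMono_eq_map, ordMono_eq_map, map_list_prod, List.map_map]
  simp [Function.comp_def]

end OrdMono

section Monomials

variable {R : Type*} [Ring R] {n : ℕ}

/-- A product over a list without repetitions in which one factor is multiplied from the left
by `y`, when `y` commutes up to sign with the factors. The sign is left unspecified. -/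
theorem mul_prod_map_eq_or_neg {ι : Type*} (y : R) (f g : ι → R) (i : ι)
    (hi : y * f i = g i ∨ y * f i = -g i) (hg : ∀ j, j ≠ i → g j = f j)
    (hy : ∀ j, j ≠ i → y * f j = f j * y ∨ y * f j = -(f j * y)) :
    ∀ l : List ι, l.Nodup → i ∈ l →
      y * (l.map f).prod = (l.map g).prod ∨ y * (l.map f).prod = -(l.map g).prod
  | [], _, h => by simp at h
  | j :: l, hl, h => by
    rw [List.nodup_cons] at hl
    simp only [List.map_cons, List.prod_cons]
    by_cases hji : j = i
    · subst hji
      have : l.map g = l.map f := List.map_congr_left fun k hk => hg k (by rintro rfl; exact hl.1 hk)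
      rw [this, ← mul_assoc]
      rcases hi with hi | hi <;> simp [hi]
    · have hil : i ∈ l := by
        rcases List.mem_cons.1 h with h | h
        · exact absurd h.symm hji
        · exact h
      have ih := mul_prod_map_eq_or_neg y f g i hi hg hy l hl.2 hil
      rw [hg j hji, ← mul_assoc]
      rcases hy j hji with e | e <;> rw [e] <;> rcases ih with ih | ih <;>
        simp [mul_assoc, ih]

/-- An element commuting up to sign with the factors commutes up to sign with the product. -/
theorem mul_prod_comm_or_neg {ι : Type*} (y : R) (f : ι → R)
    (hy : ∀ j, y * f j = f j * y ∨ y * f j = -(f j * y)) :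
    ∀ l : List ι, y * (l.map f).prod = (l.map f).prod * y ∨
      y * (l.map f).prod = -((l.map f).prod * y)
  | [] => by simp
  | j :: l => by
    simp only [List.map_cons, List.prod_cons]
    have ih := mul_prod_comm_or_neg y f hy l
    rw [← mul_assoc]
    rcases hy j with e | e <;> rw [e] <;> rcases ih with ih | ih <;> simp [mul_assoc, ih]

theorem mul_pow_comm_or_neg {y z : R} (h : y * z = z * y ∨ y * z = -(z * y)) (k : ℕ) :
    y * z ^ k = z ^ k * y ∨ y * z ^ k = -(z ^ k * y) := by
  induction k with
  | zero => simp
  | succ k ih =>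
    rw [pow_succ, ← mul_assoc]
    rcases ih with ih | ih <;> rw [ih] <;> rcases h with h | h <;> simp [mul_assoc, h]

theorem mul_ordMono (x : Fin n → R) (hx : ∀ i j, x i * x j = x j * x i) (i : Fin n)
    (α : Fin n → ℕ) : x i * ordMono x α = ordMono x (α + Pi.single i 1) := by
  have h1 : ordMono x (Pi.single i 1) = x i := by
    rw [ordMono_eq_map]
    have : ∀ l : List (Fin n), l.Nodup →
        (l.map fun j => x j ^ (Pi.single i 1 : Fin n → ℕ) j).prod = if i ∈ l then x i else 1 := by
      intro l
      induction l with
      | nil => simp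
      | cons j l ih =>
        intro hl
        rw [List.nodup_cons] at hl
        rw [List.map_cons, List.prod_cons, ih hl.2]
        by_cases hji : i = j
        · subst hji; simp [hl.1]
        · simp [hji]
    simpa using this _ (List.nodup_finRange n)
  rw [add_comm]
  have h2 := H.prod_ofFn_pow_add x (fun i j => hx i j) (Pi.single i 1) α
  change ordMono x (Pi.single i 1 + α) = ordMono x (Pi.single i 1) * ordMono x α at h2
  rw [h2, h1]

theorem zmod_two_eq (b : ZMod 2) : b = 0 ∨ b = 1 := by
  revert b; decide

/-- Multiplication by `c_i` permutes the monomials `c^β` up to sign. -/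
theorem mul_ordMono_val (c : Fin n → R) (hsq : ∀ i, c i * c i = 1)
    (hanti : ∀ i j, i ≠ j → c i * c j = -(c j * c i)) (i : Fin n) (β : Fin n → ZMod 2) :
    c i * ordMono c (fun j => (β j).val) =
      ordMono c (fun j => ((β + Pi.single i 1 : Fin n → ZMod 2) j).val) ∨
    c i * ordMono c (fun j => (β j).val) =
      -ordMono c (fun j => ((β + Pi.single i 1 : Fin n → ZMod 2) j).val) := by
  rw [ordMono_eq_map, ordMono_eq_map]
  refine mul_prod_map_eq_or_neg _ _ _ i (Or.inl ?_) ?_ ?_ _ (List.nodup_finRange n)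
    (List.mem_finRange i)
  · rcases zmod_two_eq (β i) with h | h
    · simp [h, ZMod.val_one]
    · simp [h, ZMod.val_one, hsq, show (1 + 1 : ZMod 2) = 0 from rfl]
  · intro j hj; simp [hj]
  · intro j hj
    exact mul_pow_comm_or_neg (Or.inr (hanti i j hj.symm)) _

theorem mul_ordMono_comm (x : Fin n → R) (y : R)
    (h : ∀ i, y * x i = x i * y ∨ y * x i = -(x i * y)) (α : Fin n → ℕ) :
    y * ordMono x α = ordMono x α * y ∨ y * ordMono x α = -(ordMono x α * y) := by
  rw [ordMono_eq_map]
  exact mul_prod_comm_or_neg _ _ (fun j => mul_pow_comm_or_neg (h j) _) _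

end Monomials

/-! ### The algebra generated by the polynomial and the Clifford generators -/

/-- Defining relations of the algebra `ℂ[x_1, …, x_n] ⋊ 𝒞_n`; the generator `x_i` is `inl i` and
`c_i` is `inr i`. -/
inductive PCRel (n : ℕ) : FreeAlgebra ℂ (Fin n ⊕ Fin n) → FreeAlgebra ℂ (Fin n ⊕ Fin n) → Prop
  | x_comm (i j : Fin n) : PCRel n (FreeAlgebra.ι ℂ (.inl i) * FreeAlgebra.ι ℂ (.inl j))
      (FreeAlgebra.ι ℂ (.inl j) * FreeAlgebra.ι ℂ (.inl i))
  | c_sq (i : Fin n) : PCRel n (FreeAlgebra.ι ℂ (.inr i) * FreeAlgebra.ι ℂ (.inr i)) 1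
  | c_anti (i j : Fin n) (h : i ≠ j) :
      PCRel n (FreeAlgebra.ι ℂ (.inr i) * FreeAlgebra.ι ℂ (.inr j))
        (-(FreeAlgebra.ι ℂ (.inr j) * FreeAlgebra.ι ℂ (.inr i)))
  | x_c_same (i : Fin n) : PCRel n (FreeAlgebra.ι ℂ (.inl i) * FreeAlgebra.ι ℂ (.inr i))
      (-(FreeAlgebra.ι ℂ (.inr i) * FreeAlgebra.ι ℂ (.inl i)))
  | x_c (i j : Fin n) (h : i ≠ j) :
      PCRel n (FreeAlgebra.ι ℂ (.inl i) * FreeAlgebra.ι ℂ (.inr j))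
        (FreeAlgebra.ι ℂ (.inr j) * FreeAlgebra.ι ℂ (.inl i))

/-- The polynomial-Clifford algebra `ℂ[x_1, …, x_n] ⋊ 𝒞_n`, in which `x_i` anticommutes with `c_i`
and commutes with the other `c_j`. -/
def PC (n : ℕ) : Type := RingQuot (PCRel n)

namespace PC

variable {n : ℕ}

instance : Ring (PC n) := inferInstanceAs (Ring (RingQuot (PCRel n)))

instance : Algebra ℂ (PC n) := inferInstanceAs (Algebra ℂ (RingQuot (PCRel n)))

/-- The quotient map from the free algebra. -/
def mk : FreeAlgebra ℂ (Fin n ⊕ Fin n) →ₐ[ℂ] PC n := RingQuot.mkAlgHom ℂ (PCRel n)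

theorem mk_rel {a b : FreeAlgebra ℂ (Fin n ⊕ Fin n)} (h : PCRel n a b) : mk a = mk b :=
  RingQuot.mkAlgHom_rel ℂ h

/-- The generator `x_i`. -/
def x (i : Fin n) : PC n := mk (FreeAlgebra.ι ℂ (.inl i))

/-- The generator `c_i`. -/
def c (i : Fin n) : PC n := mk (FreeAlgebra.ι ℂ (.inr i))

theorem x_comm (i j : Fin n) : (x i * x j : PC n) = x j * x i := by
  simpa [x] using mk_rel (PCRel.x_comm i j)

theorem c_sq (i : Fin n) : (c i * c i : PC n) = 1 := by
  simpa [c] using mk_rel (PCRel.c_sq i)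

theorem c_anti (i j : Fin n) (h : i ≠ j) : (c i * c j : PC n) = -(c j * c i) := by
  simpa [c] using mk_rel (PCRel.c_anti i j h)

theorem x_c_same (i : Fin n) : (x i * c i : PC n) = -(c i * x i) := by
  simpa [c, x] using mk_rel (PCRel.x_c_same i)

theorem x_c (i j : Fin n) (h : i ≠ j) : (x i * c j : PC n) = c j * x i := by
  simpa [c, x] using mk_rel (PCRel.x_c i j h)

section Lift

variable {R : Type*} [Ring R] [Algebra ℂ R]

/-- The relations of the polynomial-Clifford algebra, for elements `x_i`, `c_i` of a ring. -/
structure Satisfies (x c : Fin n → R) : Prop where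
  x_comm : ∀ i j, x i * x j = x j * x i
  c_sq : ∀ i, c i * c i = 1
  c_anti : ∀ i j, i ≠ j → c i * c j = -(c j * c i)
  x_c_same : ∀ i, x i * c i = -(c i * x i)
  x_c : ∀ i j, i ≠ j → x i * c j = c j * x i

/-- The universal property of the polynomial-Clifford algebra. -/
def lift (x c : Fin n → R) (h : Satisfies x c) : PC n →ₐ[ℂ] R :=
  RingQuot.liftAlgHom ℂ ⟨FreeAlgebra.lift ℂ (Sum.elim x c), by
    intro a b hab
    cases hab with
    | x_comm i j => simpa using h.x_comm i j
    | c_sq i => simpa using h.c_sq i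
    | c_anti i j hij => simpa using h.c_anti i j hij
    | x_c_same i => simpa using h.x_c_same i
    | x_c i j hij => simpa using h.x_c i j hij⟩

@[simp] theorem lift_x (y d : Fin n → R) (h : Satisfies y d) (i : Fin n) :
    lift y d h (x i) = y i := by
  exact (RingQuot.liftAlgHom_mkAlgHom_apply ℂ _ _ _).trans (by simp)

@[simp] theorem lift_c (y d : Fin n → R) (h : Satisfies y d) (i : Fin n) :
    lift y d h (c i) = d i := by
  exact (RingQuot.liftAlgHom_mkAlgHom_apply ℂ _ _ _).trans (by simp)

/-- Induction on the generators, with elements built up by multiplication from the left. -/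
theorem induction_left {p : PC n → Prop} (one : p 1) (add : ∀ a b, p a → p b → p (a + b))
    (smul : ∀ (r : ℂ) a, p a → p (r • a)) (x_mul : ∀ i a, p a → p (x i * a))
    (c_mul : ∀ i a, p a → p (c i * a)) (a : PC n) : p a := by
  obtain ⟨f, rfl⟩ := RingQuot.mkAlgHom_surjective ℂ (PCRel n) a
  change p (mk f)
  suffices h : ∀ b, p b → p (mk f * b) by simpa using h 1 one
  induction f using FreeAlgebra.induction with
  | grade0 r =>
    intro b hb
    rw [AlgHom.commutes, ← Algebra.smul_def]
    exact smul r b hb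
  | grade1 g =>
    intro b hb
    cases g with
    | inl i => exact x_mul i b hb
    | inr i => exact c_mul i b hb
  | mul f g hf hg =>
    intro b hb
    rw [map_mul, mul_assoc]
    exact hf _ (hg _ hb)
  | add f g hf hg =>
    intro b hb
    rw [map_add, add_mul]
    exact add _ _ (hf _ hb) (hg _ hb)

end Lift

/-- The monomial `x^α c^β`. -/
def mono (t : (Fin n → ℕ) × (Fin n → ZMod 2)) : PC n :=
  ordMono x t.1 * ordMono c fun i => (t.2 i).val

theorem span_mono : Submodule.span ℂ (Set.range (mono (n := n))) = ⊤ := by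
  refine eq_top_iff.2 fun a _ => ?_
  have hmem : ∀ t, mono t ∈ Submodule.span ℂ (Set.range (mono (n := n))) := fun t =>
    Submodule.subset_span ⟨t, rfl⟩
  have hstab : ∀ y : PC n, (∀ t, y * mono t ∈ Submodule.span ℂ (Set.range (mono (n := n)))) →
      ∀ a, a ∈ Submodule.span ℂ (Set.range (mono (n := n))) →
        y * a ∈ Submodule.span ℂ (Set.range (mono (n := n))) := by
    intro y hy a ha
    induction ha using Submodule.span_induction with
    | mem a ha => obtain ⟨t, rfl⟩ := ha; exact hy t
    | zero => simp
    | add a b _ _ ha hb => rw [mul_add]; exact add_mem ha hb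
    | smul r a _ ha => rw [mul_smul_comm]; exact Submodule.smul_mem _ _ ha
  induction a using induction_left with
  | one =>
    have : mono (n := n) (0, 0) = 1 := by
      have h := ordMono_zero (c : Fin n → PC n)
      simp only [mono, ordMono_zero, one_mul]
      simpa [Pi.zero_def] using h
    rw [← this]; exact hmem _
  | add a b ha hb => exact add_mem (ha trivial) (hb trivial)
  | smul r a ha => exact Submodule.smul_mem _ _ (ha trivial)
  | x_mul i a ha =>
    refine hstab _ (fun t => ?_) a (ha trivial)
    rw [mono, ← mul_assoc, mul_ordMono x x_comm]
    exact hmem (t.1 + Pi.single i 1, t.2)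
  | c_mul i a ha =>
    refine hstab _ (fun t => ?_) a (ha trivial)
    have h1 : c i * ordMono x t.1 = ordMono x t.1 * c i ∨
        c i * ordMono x t.1 = -(ordMono x t.1 * c i) := by
      refine mul_ordMono_comm _ _ (fun j => ?_) _
      by_cases hij : j = i
      · subst hij; right; rw [x_c_same, neg_neg]
      · left; rw [x_c j i hij]
    have h2 := mul_ordMono_val c c_sq c_anti i t.2
    have h3 := hmem (t.1, t.2 + Pi.single i 1)
    rw [mono] at h3 ⊢
    rw [← mul_assoc]
    rcases h1 with h1 | h1 <;> rcases h2 with h2 | h2 <;> rw [h1]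
    · rwa [mul_assoc, h2]
    · rw [mul_assoc, h2, mul_neg]; exact neg_mem h3
    · rw [neg_mul, mul_assoc, h2]; exact neg_mem h3
    · rw [neg_mul, mul_assoc, h2, mul_neg, neg_neg]; exact h3

/-! ### The monomial representation of the polynomial-Clifford algebra -/

/-- The nontrivial character of `ZMod 2`. -/
def chi (b : ZMod 2) : ℂ := (-1) ^ b.val

theorem chi_add (a b : ZMod 2) : chi (a + b) = chi a * chi b := by
  rcases zmod_two_eq a with rfl | rfl <;> rcases zmod_two_eq b with rfl | rfl <;>
    simp [chi, ZMod.val_one, show (1 + 1 : ZMod 2) = 0 from rfl]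

theorem chi_one : chi 1 = -1 := by simp [chi, ZMod.val_one]

theorem chi_mul_self (a : ZMod 2) : chi a * chi a = 1 := by
  rcases zmod_two_eq a with rfl | rfl <;> simp [chi, ZMod.val_one]

/-- The space with basis the exponents `(α, β)`, on which the polynomial-Clifford algebra acts. -/
abbrev Expo (n : ℕ) : Type := (Fin n → ℕ) × (Fin n → ZMod 2) →₀ ℂ

/-- The action of `x_i`: it raises the `i`-th exponent. -/
def opX (i : Fin n) : Module.End ℂ (Expo n) :=
  Finsupp.lift _ ℂ _ fun t => Finsupp.single (t.1 + Pi.single i 1, t.2) 1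

/-- The parity of the number of sign changes in moving `c_i` past `x^α` and into its place
in `c^β`. -/
def par (i : Fin n) (t : (Fin n → ℕ) × (Fin n → ZMod 2)) : ZMod 2 :=
  (t.1 i : ZMod 2) + ∑ j ∈ Finset.univ.filter (· < i), t.2 j

/-- The action of `c_i`. -/
def opC (i : Fin n) : Module.End ℂ (Expo n) :=
  Finsupp.lift _ ℂ _ fun t => Finsupp.single (t.1, t.2 + Pi.single i 1) (chi (par i t))

theorem opX_single (i : Fin n) (t : (Fin n → ℕ) × (Fin n → ZMod 2)) (r : ℂ) :
    opX i (Finsupp.single t r) = Finsupp.single (t.1 + Pi.single i 1, t.2) r := by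
  simp [opX]

theorem opC_single (i : Fin n) (t : (Fin n → ℕ) × (Fin n → ZMod 2)) (r : ℂ) :
    opC i (Finsupp.single t r)
      = Finsupp.single (t.1, t.2 + Pi.single i 1) (chi (par i t) * r) := by
  simp [opC, mul_comm]

theorem par_add_c (i j : Fin n) (α : Fin n → ℕ) (β : Fin n → ZMod 2) :
    par i (α, β + Pi.single j 1) = par i (α, β) + if j < i then 1 else 0 := by
  simp only [par, Pi.add_apply, Finset.sum_add_distrib, add_assoc]
  congr 2
  rw [Finset.sum_filter]
  by_cases h : j < i
  · rw [Finset.sum_eq_single j] <;> simp +contextual [h]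
  · rw [Finset.sum_eq_zero]
    · simp [h]
    · intro k _
      by_cases hk : k = j
      · subst hk; simp [h]
      · simp [hk]

theorem par_add_x (i j : Fin n) (α : Fin n → ℕ) (β : Fin n → ZMod 2) :
    par i (α + Pi.single j 1, β) = par i (α, β) + if j = i then 1 else 0 := by
  by_cases h : j = i
  · subst h; simp [par]; ring
  · simp [par, h, Ne.symm h]

/-- The operators on exponent vectors satisfy the relations of the polynomial-Clifford algebra: the
sign in the action of `c_i` counts the generators it anticommutes with on the way to its place. -/
theorem op_satisfies : Satisfies (opX : Fin n → Module.End ℂ (Expo n)) opC where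
  x_comm i j := by
    refine Finsupp.lhom_ext fun t r => ?_
    simp only [Module.End.mul_apply, opX_single, add_right_comm]
  c_sq i := by
    refine Finsupp.lhom_ext fun t r => ?_
    obtain ⟨α, β⟩ := t
    have : β + Pi.single i 1 + Pi.single i 1 = β := by
      rw [add_assoc, ← Pi.single_add, show (1 + 1 : ZMod 2) = 0 from rfl]; simp
    rw [Module.End.mul_apply, opC_single, opC_single, par_add_c, if_neg (lt_irrefl i), add_zero,
      ← mul_assoc, chi_mul_self, one_mul, this, Module.End.one_apply]
  c_anti i j hij := by
    refine Finsupp.lhom_ext fun t r => ?_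
    obtain ⟨α, β⟩ := t
    simp only [Module.End.mul_apply, LinearMap.neg_apply, opC_single, par_add_c, ← mul_assoc,
      ← Finsupp.single_neg, add_right_comm β (Pi.single i 1)]
    congr 1
    rcases lt_or_gt_of_ne hij with h | h
    · rw [if_neg h.not_gt, if_pos h, add_zero, chi_add, chi_one]; ring
    · rw [if_pos h, if_neg h.not_gt, add_zero, chi_add, chi_one]; ring
  x_c_same i := by
    refine Finsupp.lhom_ext fun t r => ?_
    obtain ⟨α, β⟩ := t
    simp only [Module.End.mul_apply, LinearMap.neg_apply, opC_single, opX_single, par_add_x,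
      chi_add, chi_one, ← Finsupp.single_neg, if_true, mul_neg, mul_one, neg_mul, neg_neg]
  x_c i j hij := by
    refine Finsupp.lhom_ext fun t r => ?_
    obtain ⟨α, β⟩ := t
    simp only [Module.End.mul_apply, opC_single, opX_single, par_add_x, hij, if_false, add_zero]

theorem prod_opX_single (α : Fin n → ℕ) (γ : Fin n → ℕ) (β : Fin n → ZMod 2) (r : ℂ) :
    ∀ l : List (Fin n), (l.map fun i => (opX i : Module.End ℂ (Expo n)) ^ α i).prod
      (Finsupp.single (γ, β) r)
      = Finsupp.single (γ + (l.map fun i => Pi.single i (α i)).sum, β) r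
  | [] => by simp
  | i :: l => by
    have h : ∀ (k : ℕ) (γ : Fin n → ℕ), ((opX i : Module.End ℂ (Expo n)) ^ k)
        (Finsupp.single (γ, β) r) = Finsupp.single (γ + Pi.single i k, β) r := by
      intro k
      induction k with
      | zero => simp
      | succ k ih =>
        intro γ
        rw [pow_succ, Module.End.mul_apply, opX_single, ih, add_assoc, ← Pi.single_add,
          add_comm 1 k]
    rw [List.map_cons, List.prod_cons, Module.End.mul_apply, prod_opX_single α γ β r l, h]
    rw [List.map_cons, List.sum_cons, add_assoc,
      add_comm (Pi.single (M := fun _ => ℕ) i (α i))]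

theorem prod_opC_single (β : Fin n → ZMod 2) (α : Fin n → ℕ) (γ : Fin n → ZMod 2) :
    ∀ l : List (Fin n), ∃ e : ℂˣ,
      (l.map fun i => (opC i : Module.End ℂ (Expo n)) ^ (β i).val).prod
        (Finsupp.single (α, γ) 1)
      = Finsupp.single (α, γ + (l.map fun i => Pi.single i (β i)).sum) (e : ℂ)
  | [] => ⟨1, by simp⟩
  | i :: l => by
    obtain ⟨e, he⟩ := prod_opC_single β α γ l
    rw [List.map_cons, List.prod_cons, Module.End.mul_apply, he]
    rcases zmod_two_eq (β i) with h | h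
    · exact ⟨e, by simp [h]⟩
    · refine ⟨⟨chi (par i (α, γ + (l.map fun i => Pi.single i (β i)).sum)), _, chi_mul_self _,
        chi_mul_self _⟩ * e, ?_⟩
      rw [h, ZMod.val_one, pow_one, opC_single, Units.val_mul, List.map_cons, List.sum_cons, h,
        add_assoc, add_comm (Pi.single i 1)]

/-- In the monomial representation `x^α c^β` sends the basis vector `(0, 0)` to
a multiple of `(α, β)`, so the monomials are linearly independent. -/
theorem linearIndependent_mono : LinearIndependent ℂ (mono (n := n)) := by
  have hev : ∀ t : (Fin n → ℕ) × (Fin n → ZMod 2), ∃ e : ℂˣ,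
      lift opX opC op_satisfies (mono t) (Finsupp.single (0, 0) 1)
        = e • Finsupp.single t (1 : ℂ) := by
    rintro ⟨α, β⟩
    obtain ⟨e, he⟩ := prod_opC_single β 0 0 (List.finRange n)
    refine ⟨e, ?_⟩
    have hs : ∀ {K : Type} [AddCommMonoid K] (f : Fin n → K),
        ((List.finRange n).map fun i => (Pi.single i (f i) : Fin n → K)).sum = f := by
      intro K _ f
      rw [← List.ofFn_eq_map, List.sum_ofFn, Finset.univ_sum_single]
    rw [mono, map_mul, map_ordMono, map_ordMono]
    simp only [lift_x, lift_c]
    rw [Module.End.mul_apply, ordMono_eq_map, ordMono_eq_map, he, prod_opX_single, hs, hs,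
      zero_add, zero_add, Units.smul_def, Finsupp.smul_single, smul_eq_mul, mul_one]
  choose e he using hev
  have hli : LinearIndependent ℂ fun t => Finsupp.single (M := ℂ)
      (t : (Fin n → ℕ) × (Fin n → ZMod 2)) 1 := by
    simpa using (Finsupp.basisSingleOne (R := ℂ)
      (ι := (Fin n → ℕ) × (Fin n → ZMod 2))).linearIndependent
  have h := hli.units_smul e
  refine LinearIndependent.of_comp ((LinearMap.applyₗ (R := ℂ) (Finsupp.single (0, 0) 1)).comp
    (lift opX opC op_satisfies).toLinearMap) ?_
  convert h using 1
  funext t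
  simpa using he t

end PC

/-! ### Rank two computations -/

section RankTwo

variable {R : Type*} [Ring R]

/-- `q` can be moved to the right of `x`, at the price of changing `x`. -/
def Slides (q x : R) : Prop := ∃ z, q * x = z * q

/-- If `f` and `g` move past `x` with the same correction term, then `f - g` slides past `x`. -/
theorem slides_sub {f g x : R} (z r : R) (hf : f * x = z * f + r) (hg : g * x = z * g + r) :
    Slides (f - g) x :=
  ⟨z, by rw [sub_mul, hf, hg, mul_sub]; abel⟩

theorem Slides.neg {q x : R} (h : Slides q x) : Slides q (-x) := by
  obtain ⟨z, hz⟩ := h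
  exact ⟨-z, by simp [hz]⟩

theorem Slides.of_neg {q x : R} (h : Slides q (-x)) : Slides q x := by
  simpa using h.neg

theorem Slides.sub_comm {f g x : R} (h : Slides (f - g) x) : Slides (g - f) x := by
  obtain ⟨z, hz⟩ := h
  exact ⟨z, by rw [← neg_sub, neg_mul, hz, mul_neg]⟩

theorem mul_mul_eq {p q r : R} (h : p * q = r) (z : R) : p * (q * z) = r * z := by
  rw [← mul_assoc, h]

/-- If `a`, `b` and `p` have no correction terms at a letter then neither has `p a - b p`. -/
theorem intertwine_slides {a b p x x' y y' : R} (ha : a * x = x' * a) (hp : p * x' = y' * p)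
    (hp' : p * x = y * p) (hb : b * y = y' * b) : Slides (p * a - b * p) x :=
  slides_sub y' 0 (by rw [mul_assoc, ha, ← mul_assoc, hp, mul_assoc, add_zero])
    (by rw [mul_assoc, hp', ← mul_assoc, hb, mul_assoc, add_zero])

variable [Algebra ℂ R] {u v : ℂ}

/-- The cross relations of a reflection `a` exchanging `x` with `y` and `c` with `d`. -/
structure IsRefl (u : ℂ) (a x y c d : R) : Prop where
  anti : c * d = -(d * c)
  ax : a * x = y * a - u • (1 - d * c)
  ay : a * y = x * a + u • (1 - c * d)
  ac : a * c = d * a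
  ad : a * d = c * a

/-- The cross relations of a reflection `b` changing the signs of `y` and `d`. -/
structure IsSign (v : ℂ) (b y d : R) : Prop where
  bx : b * y = -(y * b) - v • 1
  bc : b * d = -(d * b)

/-- The cross relations are invariant under the longest element of the group of signed
permutations of two letters. -/
theorem IsRefl.symm_neg {a x y c d : R} (h : IsRefl u a x y c d) :
    IsRefl u a (-y) (-x) (-d) (-c) where
  anti := by simp [h.anti]
  ax := by simp [h.ay]; abel
  ay := by simp [h.ax]; abel
  ac := by simp [h.ad]
  ad := by simp [h.ac]

theorem mul_corr {a c d c' d' : R} (hc : a * c = c' * a) (hd : a * d = d' * a) (u : ℂ) :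
    a * (u • (1 - d * c)) = u • (1 - d' * c') * a := by
  rw [mul_smul_comm, smul_mul_assoc, mul_sub, sub_mul, ← mul_assoc, hd, mul_assoc, hc, ← mul_assoc,
    mul_one, one_mul]

set_option linter.unusedSimpArgs false in
theorem IsRefl.sq_slides {a x y c d : R} (h : IsRefl u a x y c d) :
    Slides (a * a - 1) x ∧ Slides (a * a - 1) y ∧ Slides (a * a - 1) c ∧ Slides (a * a - 1) d := by
  have e1 := mul_corr h.ac h.ad u
  have e2 := mul_corr h.ad h.ac u
  obtain ⟨-, ax, ay, ac, ad⟩ := h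
  generalize u • (1 - d * c) = e at *
  generalize u • (1 - c * d) = e' at *
  refine ⟨slides_sub x 0 ?_ ?_, slides_sub y 0 ?_ ?_, slides_sub c 0 ?_ ?_,
    slides_sub d 0 ?_ ?_⟩ <;>
  simp only [mul_assoc, ax, ay, ac, ad, e1, e2, mul_mul_eq ac, mul_mul_eq ad, mul_mul_eq ax,
    mul_mul_eq ay, mul_sub, mul_add, sub_mul, add_mul, one_mul, mul_one] <;> abel

theorem IsSign.sq_slides {b y d : R} (h : IsSign v b y d) :
    Slides (b * b - 1) y ∧ Slides (b * b - 1) d := by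
  obtain ⟨bx, bc⟩ := h
  refine ⟨slides_sub y 0 ?_ ?_, slides_sub d 0 ?_ ?_⟩ <;>
  simp only [mul_assoc, bx, bc, mul_mul_eq bx, mul_mul_eq bc, mul_sub, sub_mul, mul_neg, neg_mul,
    one_mul, mul_one, mul_smul_comm, smul_mul_assoc] <;> abel

set_option linter.unusedSimpArgs false in
/-- The braid relation of type `A_2`. -/
theorem IsRefl.braid_slides {a b x₁ x₂ x₃ c₁ c₂ c₃ : R} (ha : IsRefl u a x₁ x₂ c₁ c₂)
    (hb : IsRefl u b x₂ x₃ c₂ c₃) (ha2 : a * a = 1) (hb2 : b * b = 1)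
    (ax₃ : a * x₃ = x₃ * a) (ac₃ : a * c₃ = c₃ * a) (bx₁ : b * x₁ = x₁ * b)
    (bc₁ : b * c₁ = c₁ * b) :
    (Slides (a * b * a - b * a * b) x₁ ∧ Slides (a * b * a - b * a * b) x₂ ∧
      Slides (a * b * a - b * a * b) x₃) ∧
    (Slides (a * b * a - b * a * b) c₁ ∧ Slides (a * b * a - b * a * b) c₂ ∧
      Slides (a * b * a - b * a * b) c₃) := by
  have a12 := mul_corr ha.ac ha.ad u
  have a21 := mul_corr ha.ad ha.ac u
  have a13 := mul_corr ha.ac ac₃ u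
  have a31 := mul_corr ac₃ ha.ac u
  have a23 := mul_corr ha.ad ac₃ u
  have a32 := mul_corr ac₃ ha.ad u
  have b12 := mul_corr bc₁ hb.ac u
  have b21 := mul_corr hb.ac bc₁ u
  have b13 := mul_corr bc₁ hb.ad u
  have b31 := mul_corr hb.ad bc₁ u
  have b23 := mul_corr hb.ac hb.ad u
  have b32 := mul_corr hb.ad hb.ac u
  obtain ⟨-, ax, ay, ac, ad⟩ := ha
  obtain ⟨-, bx, by', bc, bd⟩ := hb
  generalize u • (1 - c₂ * c₁) = e₁₂ at *
  generalize u • (1 - c₁ * c₂) = e₂₁ at *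
  generalize u • (1 - c₃ * c₁) = e₁₃ at *
  generalize u • (1 - c₁ * c₃) = e₃₁ at *
  generalize u • (1 - c₃ * c₂) = e₂₃ at *
  generalize u • (1 - c₂ * c₃) = e₃₂ at *
  refine ⟨⟨slides_sub x₃ (-e₁₃ - e₂₃ * a * b) ?_ ?_, slides_sub x₂ (e₃₂ * a * b - e₁₂ * b * a) ?_ ?_,
    slides_sub x₁ (e₃₁ + e₂₁ * b * a) ?_ ?_⟩, slides_sub c₃ 0 ?_ ?_, slides_sub c₂ 0 ?_ ?_,
    slides_sub c₁ 0 ?_ ?_⟩ <;>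
  simp only [mul_assoc, ax, ay, ac, ad, bx, by', bc, bd, ax₃, ac₃, bx₁, bc₁, a12, a21, a13, a31, a23,
    a32, b12, b21, b13, b31, b23, b32, mul_mul_eq ax, mul_mul_eq ay, mul_mul_eq ac, mul_mul_eq ad,
    mul_mul_eq bx, mul_mul_eq by', mul_mul_eq bc, mul_mul_eq bd, mul_mul_eq ax₃, mul_mul_eq ac₃,
    mul_mul_eq bx₁, mul_mul_eq bc₁, mul_mul_eq a12, mul_mul_eq a21, mul_mul_eq a13, mul_mul_eq a31,
    mul_mul_eq a23, mul_mul_eq a32, mul_mul_eq b12, mul_mul_eq b21, mul_mul_eq b13, mul_mul_eq b31,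
    mul_mul_eq b23, mul_mul_eq b32, mul_mul_eq ha2, mul_mul_eq hb2, ha2, hb2, mul_sub, mul_add,
    sub_mul, add_mul, neg_mul, one_mul, mul_one] <;> abel

set_option linter.unusedSimpArgs false in
/-- The braid relation of type `B_2`. -/
theorem IsRefl.braid_four_slides {a b x y c d : R} (ha : IsRefl u a x y c d)
    (hb : IsSign v b y d) (ha2 : a * a = 1) (hb2 : b * b = 1)
    (bx : b * x = x * b) (bc : b * c = c * b) :
    (Slides (a * b * a * b - b * a * b * a) x ∧ Slides (a * b * a * b - b * a * b * a) y) ∧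
    (Slides (a * b * a * b - b * a * b * a) c ∧ Slides (a * b * a * b - b * a * b * a) d) := by
  have a1 := mul_corr ha.ac ha.ad u
  have a2 := mul_corr ha.ad ha.ac u
  have hdb : b * d = (-d) * b := by rw [hb.bc, neg_mul]
  have b1 := mul_corr bc hdb u
  have b2 := mul_corr hdb bc u
  have hn : (-d) * c = c * d := by rw [ha.anti, neg_mul]
  have hn' : c * (-d) = d * c := by rw [mul_neg, ha.anti, neg_neg]
  rw [hn] at b1
  rw [hn'] at b2
  obtain ⟨-, ax, ay, ac, ad⟩ := ha
  obtain ⟨by', bd⟩ := hb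
  generalize u • (1 - d * c) = e at *
  generalize u • (1 - c * d) = e' at *
  refine ⟨⟨slides_sub (-x) (-e' * b * a * b - v • b - e * a) ?_ ?_,
    slides_sub (-y) (e * b * a * b - e' * a - v • (a * b * a)) ?_ ?_⟩,
    slides_sub (-c) 0 ?_ ?_, slides_sub (-d) 0 ?_ ?_⟩ <;>
  simp only [mul_assoc, ax, ay, ac, ad, bx, bc, by', bd, a1, a2, b1, b2, mul_mul_eq ax,
    mul_mul_eq ay, mul_mul_eq ac, mul_mul_eq ad, mul_mul_eq bx, mul_mul_eq bc, mul_mul_eq by',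
    mul_mul_eq bd, mul_mul_eq a1, mul_mul_eq a2, mul_mul_eq b1, mul_mul_eq b2, mul_mul_eq ha2,
    mul_mul_eq hb2, ha2, hb2, mul_sub, mul_add, sub_mul, add_mul, neg_mul, mul_neg, one_mul,
    mul_one, smul_mul_assoc, mul_smul_comm] <;> abel

set_option linter.unusedSimpArgs false in
/-- In type `D` the reflections in `e_{n-1} - e_n` and `e_{n-1} + e_n` commute. -/
theorem IsRefl.comm_neg_slides {a b x y c d : R} (ha : IsRefl u a x y c d)
    (hb : IsRefl u b x (-y) c (-d)) :
    (Slides (a * b - b * a) x ∧ Slides (a * b - b * a) y) ∧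
    (Slides (a * b - b * a) c ∧ Slides (a * b - b * a) d) := by
  have a1 := mul_corr ha.ac ha.ad u
  have a2 := mul_corr ha.ad ha.ac u
  have b1 := mul_corr hb.ac hb.ad u
  have b2 := mul_corr hb.ad hb.ac u
  have anti := ha.anti
  obtain ⟨-, ax, ay, ac, ad⟩ := ha
  obtain ⟨-, bx, by', bc, bd⟩ := hb
  have hn : (-d) * c = c * d := by rw [anti, neg_mul]
  have hn' : c * (-d) = d * c := by rw [mul_neg, anti, neg_neg]
  rw [hn, hn'] at b1 b2
  rw [hn] at bx
  rw [hn', mul_neg] at by'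
  rw [mul_neg] at bd
  replace by' := neg_eq_iff_eq_neg.1 by'
  replace bd := neg_eq_iff_eq_neg.1 bd
  generalize u • (1 - d * c) = e at *
  generalize u • (1 - c * d) = e' at *
  refine ⟨⟨slides_sub (-x) (-e' * b - e * a) ?_ ?_, slides_sub (-y) (e * b - e' * a) ?_ ?_⟩,
    slides_sub (-c) 0 ?_ ?_, slides_sub (-d) 0 ?_ ?_⟩ <;>
  simp only [mul_assoc, ax, ay, ac, ad, bx, bc, by', bd, a1, a2, b1, b2, mul_mul_eq ax,
    mul_mul_eq ay, mul_mul_eq ac, mul_mul_eq ad, mul_mul_eq bx, mul_mul_eq bc, mul_mul_eq by',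
    mul_mul_eq bd, mul_mul_eq a1, mul_mul_eq a2, mul_mul_eq b1, mul_mul_eq b2,
    mul_sub, mul_add, sub_mul, add_mul, neg_mul, mul_neg, neg_add, neg_sub, one_mul, mul_one] <;>
  abel

/-- If `p` intertwines the letters of two reflections `a`, `b`, then `p a - b p` slides past
the letters of `a`. -/
theorem IsRefl.intertwine_slides {a b p x y c d x' y' c' d' : R} (ha : IsRefl u a x y c d)
    (hb : IsRefl u b x' y' c' d') (hx : p * x = x' * p) (hy : p * y = y' * p)
    (hc : p * c = c' * p) (hd : p * d = d' * p) :
    (Slides (p * a - b * p) x ∧ Slides (p * a - b * p) y) ∧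
    (Slides (p * a - b * p) c ∧ Slides (p * a - b * p) d) := by
  have e1 := mul_corr hc hd u
  have e2 := mul_corr hd hc u
  refine ⟨⟨slides_sub y' (-(u • (1 - d' * c') * p)) ?_ ?_,
    slides_sub x' (u • (1 - c' * d') * p) ?_ ?_⟩, slides_sub d' 0 ?_ ?_, slides_sub c' 0 ?_ ?_⟩
  · rw [mul_assoc, ha.ax, mul_sub, e1, ← mul_assoc, hy, mul_assoc, sub_eq_add_neg]
  · rw [mul_assoc, hx, ← mul_assoc, hb.ax, sub_mul, mul_assoc, sub_eq_add_neg]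
  · rw [mul_assoc, ha.ay, mul_add, e2, ← mul_assoc, hx, mul_assoc]
  · rw [mul_assoc, hy, ← mul_assoc, hb.ay, add_mul, mul_assoc]
  · rw [mul_assoc, ha.ac, ← mul_assoc, hd, mul_assoc, add_zero]
  · rw [mul_assoc, hc, ← mul_assoc, hb.ac, mul_assoc, add_zero]
  · rw [mul_assoc, ha.ad, ← mul_assoc, hc, mul_assoc, add_zero]
  · rw [mul_assoc, hd, ← mul_assoc, hb.ad, mul_assoc, add_zero]

theorem IsSign.intertwine_slides {a b p y d y' d' : R} (ha : IsSign v a y d)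
    (hb : IsSign v b y' d') (hy : p * y = y' * p) (hd : p * d = d' * p) :
    Slides (p * a - b * p) y ∧ Slides (p * a - b * p) d := by
  refine ⟨slides_sub (-y') (-(v • p)) ?_ ?_, slides_sub (-d') 0 ?_ ?_⟩
  · rw [mul_assoc, ha.bx, mul_sub, mul_neg, ← mul_assoc, hy, mul_smul_comm, mul_one, neg_mul,
      mul_assoc, sub_eq_add_neg]
  · rw [mul_assoc, hy, ← mul_assoc, hb.bx, sub_mul, neg_mul, smul_mul_assoc, one_mul, neg_mul,
      mul_assoc, sub_eq_add_neg]
  · rw [mul_assoc, ha.bc, mul_neg, ← mul_assoc, hd, neg_mul, mul_assoc, add_zero]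
  · rw [mul_assoc, hd, ← mul_assoc, hb.bc, neg_mul, neg_mul, mul_assoc, add_zero]

/-- Conjugation of a reflection by an involution which permutes the letters. -/
theorem IsRefl.conj {a p x y c d x' y' c' d' : R} (ha : IsRefl u a x y c d) (hp : p * p = 1)
    (hanti : c' * d' = -(d' * c')) (hx : p * x' = x * p) (hy : p * y' = y * p)
    (hc : p * c' = c * p) (hd : p * d' = d * p) : IsRefl u (p * a * p) x' y' c' d' := by
  have inv : ∀ {z z' : R}, p * z' = z * p → p * z = z' * p := fun {z z'} h => by
    rw [← mul_one z, ← hp, ← mul_assoc z, ← h, ← mul_assoc, ← mul_assoc, hp, one_mul]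
  have e1 := mul_corr (inv hc) (inv hd) u
  have e2 := mul_corr (inv hd) (inv hc) u
  refine ⟨hanti, ?_, ?_, ?_, ?_⟩
  · rw [mul_assoc, hx, ← mul_assoc, mul_assoc p a, ha.ax, mul_sub, e1, ← mul_assoc, inv hy, sub_mul,
      mul_assoc _ p p, hp, mul_one, mul_assoc, mul_assoc, mul_assoc]
  · rw [mul_assoc, hy, ← mul_assoc, mul_assoc p a, ha.ay, mul_add, e2, ← mul_assoc, inv hx, add_mul,
      mul_assoc _ p p, hp, mul_one, mul_assoc, mul_assoc, mul_assoc]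
  · rw [mul_assoc, hc, ← mul_assoc, mul_assoc p a, ha.ac, ← mul_assoc, inv hd, mul_assoc, mul_assoc,
      mul_assoc]
  · rw [mul_assoc, hd, ← mul_assoc, mul_assoc p a, ha.ad, ← mul_assoc, inv hc, mul_assoc, mul_assoc,
      mul_assoc]

/-- Two reflections with the same letters differ by an element that slides past the letters. -/
theorem IsRefl.sub_slides {a b x y c d : R} (ha : IsRefl u a x y c d) (hb : IsRefl u b x y c d) :
    (Slides (a - b) x ∧ Slides (a - b) y) ∧ (Slides (a - b) c ∧ Slides (a - b) d) :=
  ⟨⟨slides_sub y _ ((ha.ax).trans (sub_eq_add_neg _ _)) ((hb.ax).trans (sub_eq_add_neg _ _)),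
    slides_sub x _ ha.ay hb.ay⟩,
    slides_sub d 0 (by rw [ha.ac, add_zero]) (by rw [hb.ac, add_zero]),
    slides_sub c 0 (by rw [ha.ad, add_zero]) (by rw [hb.ad, add_zero])⟩

end RankTwo

/-! ### Twisted derivations of the polynomial-Clifford algebra -/

/-- An algebra endomorphism `φ` of the polynomial-Clifford algebra with a linear map `D` such that
`D (a b) = D a b + φ a D b`. Such a pair encodes a relation `g a = φ(a) g + D(a)`. -/
structure Twist (n : ℕ) where
  hom : PC n →ₐ[ℂ] PC n
  der : PC n →ₗ[ℂ] PC n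
  leib : ∀ a b, der (a * b) = der a * b + hom a * der b

namespace Twist

open PC

variable {n : ℕ}

theorem der_one (t : Twist n) : t.der 1 = 0 := by
  simpa using t.leib 1 1

/-- An endomorphism with zero derivation. -/
def ofHom (f : PC n →ₐ[ℂ] PC n) : Twist n := ⟨f, 0, by simp⟩

/-- Conjugation of a twist by an involution. -/
def conj (t : Twist n) (f : PC n →ₐ[ℂ] PC n) (hf : ∀ a, f (f a) = a) : Twist n where
  hom := f.comp (t.hom.comp f)
  der := f.toLinearMap ∘ₗ t.der ∘ₗ f.toLinearMap
  leib a b := by simp [t.leib, hf]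

/-- The letters `y_i`, `e_i`, `d_i` define a twist with `x_i ↦ y_i`, `c_i ↦ e_i` under `φ` and
`x_i ↦ d_i`, `c_i ↦ 0` under `D` if the upper triangular matrices with diagonal `(y_i, x_i)` and
`(e_i, c_i)` and upper right entries `d_i` and `0` satisfy the relations of the
polynomial-Clifford algebra. -/
theorem matrix_satisfies {y e d : Fin n → PC n} (h : Satisfies y e)
    (hxx : ∀ i j, y i * d j + d i * x j = y j * d i + d j * x i)
    (hxc : ∀ i, d i * c i = -(e i * d i)) (hxc' : ∀ i j, i ≠ j → d i * c j = e j * d i) :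
    Satisfies (fun i => (!![y i, d i; 0, x i] : Matrix (Fin 2) (Fin 2) (PC n)))
      (fun i => !![e i, 0; 0, c i]) where
  x_comm i j := by simp [h.x_comm i j, x_comm i j, hxx i j]
  c_sq i := by simp [h.c_sq, c_sq, Matrix.one_fin_two]
  c_anti i j hij := by simp [h.c_anti i j hij, c_anti i j hij]
  x_c_same i := by simp [h.x_c_same i, x_c_same i, hxc i]
  x_c i j hij := by simp [h.x_c i j hij, x_c i j hij, hxc' i j hij]

theorem lift_matrix {y e d : Fin n → PC n} (h : Satisfies y e)
    (hm : Satisfies (fun i => (!![y i, d i; 0, x i] : Matrix (Fin 2) (Fin 2) (PC n)))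
      (fun i => !![e i, 0; 0, c i])) (a : PC n) :
    lift _ _ hm a = !![lift y e h a, lift _ _ hm a 0 1; 0, a] := by
  induction a using induction_left with
  | one => ext i j; fin_cases i <;> fin_cases j <;> simp
  | add a b ha hb =>
    rw [map_add, map_add]
    nth_rewrite 1 [ha, hb]
    ext i j; fin_cases i <;> fin_cases j <;> simp
  | smul r a ha =>
    rw [map_smul, map_smul]
    nth_rewrite 1 [ha]
    ext i j; fin_cases i <;> fin_cases j <;> simp
  | x_mul i a ha =>
    rw [map_mul, map_mul, lift_x, lift_x, ha]
    simp
  | c_mul i a ha =>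
    rw [map_mul, map_mul, lift_c, lift_c, ha]
    simp

/-- The twist with given values on the generators. -/
def ofLetters (y e d : Fin n → PC n) (h : Satisfies y e)
    (hxx : ∀ i j, y i * d j + d i * x j = y j * d i + d j * x i)
    (hxc : ∀ i, d i * c i = -(e i * d i)) (hxc' : ∀ i j, i ≠ j → d i * c j = e j * d i) :
    Twist n where
  hom := lift y e h
  der := Matrix.entryLinearMap ℂ (PC n) 0 1 ∘ₗ
    (lift _ _ (matrix_satisfies h hxx hxc hxc')).toLinearMap
  leib a b := by
    have hm := matrix_satisfies h hxx hxc hxc'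
    simp only [LinearMap.comp_apply, AlgHom.toLinearMap_apply, Matrix.entryLinearMap_apply, map_mul]
    conv_lhs => rw [lift_matrix h hm a, lift_matrix h hm b]
    simp [add_comm]

section ofLetters

variable {y e d : Fin n → PC n} {h : Satisfies y e}
  {hxx : ∀ i j, y i * d j + d i * x j = y j * d i + d j * x i}
  {hxc : ∀ i, d i * c i = -(e i * d i)} {hxc' : ∀ i j, i ≠ j → d i * c j = e j * d i}

@[simp] theorem ofLetters_hom_x (i : Fin n) : (ofLetters y e d h hxx hxc hxc').hom (x i) = y i := by
  simp [ofLetters]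

@[simp] theorem ofLetters_hom_c (i : Fin n) : (ofLetters y e d h hxx hxc hxc').hom (c i) = e i := by
  simp [ofLetters]

@[simp] theorem ofLetters_der_x (i : Fin n) : (ofLetters y e d h hxx hxc hxc').der (x i) = d i := by
  simp [ofLetters]

@[simp] theorem ofLetters_der_c (i : Fin n) : (ofLetters y e d h hxx hxc hxc').der (c i) = 0 := by
  simp [ofLetters]

end ofLetters

end Twist

namespace PC

variable {n : ℕ}

/-- Signed permutations of the letters preserve the relations. -/
theorem satisfies_signed (f : Fin n → Fin n) (hf : f.Injective) (g : Fin n → ℂ)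
    (hg : ∀ i, g i * g i = 1) :
    Satisfies (fun i => g i • (x (f i) : PC n)) (fun i => g i • c (f i)) where
  x_comm i j := by rw [smul_mul_smul_comm, smul_mul_smul_comm, x_comm, mul_comm]
  c_sq i := by rw [smul_mul_smul_comm, c_sq, hg, one_smul]
  c_anti i j hij := by
    rw [smul_mul_smul_comm, smul_mul_smul_comm, c_anti _ _ (hf.ne hij), mul_comm, smul_neg]
  x_c_same i := by rw [smul_mul_smul_comm, smul_mul_smul_comm, x_c_same, smul_neg]
  x_c i j hij := by rw [smul_mul_smul_comm, smul_mul_smul_comm, x_c _ _ (hf.ne hij), mul_comm]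

/-- The endomorphism given by a signed permutation of the letters. -/
def signed (f : Fin n → Fin n) (hf : f.Injective) (g : Fin n → ℂ) (hg : ∀ i, g i * g i = 1) :
    PC n →ₐ[ℂ] PC n :=
  lift _ _ (satisfies_signed f hf g hg)

section

variable {f : Fin n → Fin n} {hf : f.Injective} {g : Fin n → ℂ} {hg : ∀ i, g i * g i = 1}

@[simp] theorem signed_x (i : Fin n) : signed f hf g hg (x i) = g i • x (f i) := by simp [signed]

@[simp] theorem signed_c (i : Fin n) : signed f hf g hg (c i) = g i • c (f i) := by simp [signed]

end

/-- The sign change of the letters with index `k`. -/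
def flip (k : Fin n) : PC n →ₐ[ℂ] PC n :=
  signed id Function.injective_id (fun i => if i = k then -1 else 1) (fun i => by split_ifs <;> simp)

@[simp] theorem flip_x_self (k : Fin n) : flip k (x k) = -x k := by simp [flip]

@[simp] theorem flip_c_self (k : Fin n) : flip k (c k) = -c k := by simp [flip]

theorem flip_x {i k : Fin n} (h : i ≠ k) : flip k (x i) = x i := by simp [flip, h]

theorem flip_c {i k : Fin n} (h : i ≠ k) : flip k (c i) = c i := by simp [flip, h]

theorem flip_flip (k : Fin n) (a : PC n) : flip k (flip k a) = a := by
  induction a using induction_left with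
  | one => simp
  | add a b ha hb => simp [ha, hb]
  | smul r a ha => simp [ha]
  | x_mul i a ha => by_cases h : i = k <;> simp [h, ha, flip_x]
  | c_mul i a ha => by_cases h : i = k <;> simp [h, ha, flip_c]

theorem eq_or_eq_or_ne (k i j : Fin n) : k = i ∨ k = j ∨ (k ≠ i ∧ k ≠ j) := by tauto

theorem c_mul_c_mul_c (i j : Fin n) : c j * c i * c i = (c j : PC n) := by
  rw [mul_assoc, c_sq, mul_one]

theorem c_mul_c_mul_x (i j : Fin n) (h : i ≠ j) : c j * c i * x j = -(x j * (c j * c i) : PC n) := by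
  rw [mul_assoc, ← x_c j i h.symm, ← mul_assoc, ← mul_assoc, x_c_same, neg_mul, neg_neg]

theorem c_mul_c_mul_x' (i j : Fin n) (h : i ≠ j) :
    c j * c i * x i = -(x i * (c j * c i) : PC n) := by
  rw [mul_assoc, ← mul_assoc (x i), x_c i j h, mul_assoc, x_c_same, mul_neg, neg_neg]

end PC

namespace Twist

open PC

variable {n : ℕ}

/-- The twist of the reflection exchanging the letters with indices `i` and `j`. -/
def refl (u : ℂ) (i j : Fin n) (hij : i ≠ j) : Twist n :=
  ofLetters (fun k => x (Equiv.swap i j k)) (fun k => c (Equiv.swap i j k))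
    (fun k => if k = i then -(u • (1 - c j * c i)) else if k = j then u • (1 - c i * c j) else 0)
    (by simpa using satisfies_signed (Equiv.swap i j) (Equiv.injective _) (fun _ => 1) (by simp))
    (by
      have e1 := c_mul_c_mul_x i j hij
      have e2 := c_mul_c_mul_x' i j hij
      have e3 := c_anti i j hij
      have e4 : ∀ k, k ≠ i → k ≠ j → c j * c i * x k = x k * (c j * c i) := fun k hi hj => by
        rw [mul_assoc, ← x_c k i hi, ← mul_assoc, ← x_c k j hj, mul_assoc]
      intro k l
      rcases eq_or_eq_or_ne k i j with hk | hk | ⟨hk, hk'⟩ <;>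
        rcases eq_or_eq_or_ne l i j with hl | hl | ⟨hl, hl'⟩ <;>
        simp [*, hij.symm, Equiv.swap_apply_of_ne_of_ne, mul_sub, sub_mul, mul_add, add_mul,
          smul_sub, smul_add] <;>
        abel)
    (by
      have e5 := c_mul_c_mul_c i j
      have e6 := c_mul_c_mul_c j i
      have e7 : ∀ k l : Fin n, c k * (c k * c l) = c l := fun k l => by
        rw [← mul_assoc, c_sq, one_mul]
      intro k
      rcases eq_or_eq_or_ne k i j with rfl | rfl | ⟨hk, hk'⟩
      · simp only [Equiv.swap_apply_left, if_true, smul_mul_assoc, mul_smul_comm, sub_mul, mul_sub,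
          one_mul, mul_one, e5, e7, ← smul_neg, neg_sub]
      · simp only [Equiv.swap_apply_right, if_true, hij.symm, if_false, smul_mul_assoc,
          mul_smul_comm, sub_mul, mul_sub, one_mul, mul_one, e6, e7, ← smul_neg, neg_sub]
      · simp [hk, hk'])
    (by
      have e3 := c_anti i j hij
      have e5 := c_mul_c_mul_c i j
      have e6 := c_mul_c_mul_c j i
      have e7 : ∀ k l : Fin n, c k * (c k * c l) = c l := fun k l => by
        rw [← mul_assoc, c_sq, one_mul]
      have e8 : ∀ a b k : Fin n, k ≠ a → k ≠ b → c a * c b * c k = c k * (c a * c b) :=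
        fun a b k ha hb => by
          rw [mul_assoc, c_anti b k hb.symm, mul_neg, ← mul_assoc, c_anti a k ha.symm, neg_mul,
            neg_neg, mul_assoc]
      intro k l hkl
      rcases eq_or_eq_or_ne k i j with rfl | rfl | ⟨hk, hk'⟩
      · rcases eq_or_eq_or_ne l k j with rfl | rfl | ⟨hl, hl'⟩
        · exact absurd rfl hkl
        · rw [c_anti _ _ hij.symm]
          simp [add_mul, mul_add, e6, e7, add_comm]
        · simp [Equiv.swap_apply_of_ne_of_ne hl hl', sub_mul, mul_sub, e8 _ _ _ hl' hl]
      · rcases eq_or_eq_or_ne l i k with rfl | rfl | ⟨hl, hl'⟩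
        · rw [e3]
          simp [hij.symm, add_mul, mul_add, e5, e7, add_comm]
        · exact absurd rfl hkl
        · simp [hij.symm, Equiv.swap_apply_of_ne_of_ne hl hl', sub_mul, mul_sub, e8 _ _ _ hl hl']
      · simp [hk, hk'])

/-- The twist of the reflection changing the sign of the letters with index `k`. -/
def sign (v : ℂ) (k : Fin n) : Twist n :=
  ofLetters (fun i => flip k (x i)) (fun i => flip k (c i))
    (fun i => if i = k then -(v • 1) else 0)
    ⟨fun i j => by rw [← map_mul, x_comm, map_mul], fun i => by rw [← map_mul, c_sq, map_one],
      fun i j h => by rw [← map_mul, c_anti i j h, map_neg, map_mul],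
      fun i => by rw [← map_mul, x_c_same, map_neg, map_mul],
      fun i j h => by rw [← map_mul, x_c i j h, map_mul]⟩
    (by
      intro i j
      by_cases hi : i = k <;> by_cases hj : j = k <;> simp [*, flip_x])
    (by
      intro i
      by_cases hi : i = k
      · subst hi; simp
      · simp [hi])
    (by
      intro i j hij
      by_cases hi : i = k
      · subst hi; simp [flip_c hij.symm]
      · simp [hi])

end Twist

/-! ### Reflections acting on families of letters -/

section Families

variable {R : Type*} [Ring R] {n : ℕ}

/-- `q` slides past all letters `X_k` and `C_k`. -/
def SlidesAll (q : R) (X C : Fin n → R) : Prop := ∀ k, Slides q (X k) ∧ Slides q (C k)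

theorem SlidesAll.sub_comm {f g : R} {X C : Fin n → R} (h : SlidesAll (f - g) X C) :
    SlidesAll (g - f) X C := fun k => ⟨(h k).1.sub_comm, (h k).2.sub_comm⟩

/-- If `f` and `g` move past `x` alike without correction term then `f - g` slides past `x`. -/
theorem slides_of_eq {f g x : R} (z : R) (hf : f * x = z * f) (hg : g * x = z * g) :
    Slides (f - g) x :=
  slides_sub z 0 (by rw [hf, add_zero]) (by rw [hg, add_zero])

theorem word_three_comm {a b x : R} (ha : a * x = x * a) (hb : b * x = x * b) :
    a * b * a * x = x * (a * b * a) := by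
  simp only [mul_assoc, ha, mul_mul_eq ha, mul_mul_eq hb]

theorem word_four_comm {a b x : R} (ha : a * x = x * a) (hb : b * x = x * b) :
    a * b * a * b * x = x * (a * b * a * b) := by
  simp only [mul_assoc, hb, mul_mul_eq ha, mul_mul_eq hb]

variable [Algebra ℂ R] {u v : ℂ}

theorem Slides.of_smul {q x : R} {r : ℂ} (hr : r ≠ 0) (h : Slides q (r • x)) : Slides q x := by
  obtain ⟨z, hz⟩ := h
  refine ⟨r⁻¹ • z, ?_⟩
  rw [smul_mul_assoc, ← hz, mul_smul_comm, smul_smul, inv_mul_cancel₀ hr, one_smul]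

/-- `a` is a reflection exchanging the letters with index `i` with the `ε`-fold of the letters with
index `j`, and commuting with the other letters. -/
structure ReflAt (u : ℂ) (a : R) (X C : Fin n → R) (i j : Fin n) (ε : ℂ) : Prop where
  refl : IsRefl u a (X i) (ε • X j) (C i) (ε • C j)
  comm_x : ∀ k, k ≠ i → k ≠ j → a * X k = X k * a
  comm_c : ∀ k, k ≠ i → k ≠ j → a * C k = C k * a
  ne : ε ≠ 0

/-- `b` is a reflection changing the sign of the letters with index `k`, and commuting with the
other letters. -/
structure SignAt (v : ℂ) (b : R) (X C : Fin n → R) (k : Fin n) : Prop where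
  sign : IsSign v b (X k) (C k)
  comm_x : ∀ l, l ≠ k → b * X l = X l * b
  comm_c : ∀ l, l ≠ k → b * C l = C l * b

/-- A statement about letters follows from the case of the two letters moved by a reflection
and the case of the other letters. -/
theorem slidesAll_of_pair {q : R} {X C : Fin n → R} {i j : Fin n} {ε : ℂ} (hε : ε ≠ 0)
    (h : (Slides q (X i) ∧ Slides q (ε • X j)) ∧ (Slides q (C i) ∧ Slides q (ε • C j)))
    (h' : ∀ k, k ≠ i → k ≠ j → Slides q (X k) ∧ Slides q (C k)) : SlidesAll q X C := by
  intro k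
  rcases PC.eq_or_eq_or_ne k i j with rfl | rfl | ⟨hi, hj⟩
  · exact ⟨h.1.1, h.2.1⟩
  · exact ⟨h.1.2.of_smul hε, h.2.2.of_smul hε⟩
  · exact h' k hi hj

variable {X C Y E : Fin n → R} {a b p : R} {i j k : Fin n} {ε : ℂ}

theorem ReflAt.smul_comm_x (hb : ReflAt u b X C i j ε) (r : ℂ) (l : Fin n) (hi : l ≠ i)
    (hj : l ≠ j) : b * r • X l = r • X l * b := by
  rw [mul_smul_comm, hb.comm_x l hi hj, smul_mul_assoc]

theorem ReflAt.smul_comm_c (hb : ReflAt u b X C i j ε) (r : ℂ) (l : Fin n) (hi : l ≠ i)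
    (hj : l ≠ j) : b * r • C l = r • C l * b := by
  rw [mul_smul_comm, hb.comm_c l hi hj, smul_mul_assoc]

theorem ReflAt.sq_slidesAll (ha : ReflAt u a X C i j ε) : SlidesAll (a * a - 1) X C := by
  obtain ⟨h1, h2, h3, h4⟩ := ha.refl.sq_slides
  refine slidesAll_of_pair ha.ne ⟨⟨h1, h2⟩, h3, h4⟩ fun k hi hj => ?_
  exact ⟨slides_of_eq (X k) (by rw [mul_assoc, ha.comm_x k hi hj, ← mul_assoc, ha.comm_x k hi hj,
      mul_assoc]) (by simp),
    slides_of_eq (C k) (by rw [mul_assoc, ha.comm_c k hi hj, ← mul_assoc, ha.comm_c k hi hj,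
      mul_assoc]) (by simp)⟩

theorem SignAt.sq_slidesAll (hb : SignAt v b X C k) : SlidesAll (b * b - 1) X C := by
  intro l
  by_cases hl : l = k
  · subst hl; exact hb.sign.sq_slides
  · exact ⟨slides_of_eq (X l) (by rw [mul_assoc, hb.comm_x l hl, ← mul_assoc, hb.comm_x l hl,
        mul_assoc]) (by simp),
      slides_of_eq (C l) (by rw [mul_assoc, hb.comm_c l hl, ← mul_assoc, hb.comm_c l hl,
        mul_assoc]) (by simp)⟩

theorem ReflAt.braid_slidesAll (ha : ReflAt u a X C i j 1) (hb : ReflAt u b X C j k ε)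
    (hik : i ≠ k) (hij : i ≠ j) (hjk : j ≠ k) (ha2 : a * a = 1) (hb2 : b * b = 1) :
    SlidesAll (a * b * a - b * a * b) X C := by
  have h1 := ha.refl
  rw [one_smul, one_smul] at h1
  obtain ⟨⟨hx1, hx2, hx3⟩, hc1, hc2, hc3⟩ := h1.braid_slides hb.refl ha2 hb2
    (ha.smul_comm_x ε k hik.symm hjk.symm) (ha.smul_comm_c ε k hik.symm hjk.symm)
    (hb.comm_x i hij hik) (hb.comm_c i hij hik)
  refine slidesAll_of_pair hb.ne ⟨⟨hx2, hx3⟩, hc2, hc3⟩ fun l hj hk => ?_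
  by_cases hi : l = i
  · subst hi; exact ⟨hx1, hc1⟩
  · exact ⟨slides_of_eq (X l) (word_three_comm (ha.comm_x l hi hj) (hb.comm_x l hj hk))
        (word_three_comm (hb.comm_x l hj hk) (ha.comm_x l hi hj)),
      slides_of_eq (C l) (word_three_comm (ha.comm_c l hi hj) (hb.comm_c l hj hk))
        (word_three_comm (hb.comm_c l hj hk) (ha.comm_c l hi hj))⟩

theorem ReflAt.braid_four_slidesAll (ha : ReflAt u a X C i j 1) (hb : SignAt v b X C j)
    (hij : i ≠ j) (ha2 : a * a = 1) (hb2 : b * b = 1) :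
    SlidesAll (a * b * a * b - b * a * b * a) X C := by
  have h1 := ha.refl
  rw [one_smul, one_smul] at h1
  have h2 := h1.braid_four_slides hb.sign ha2 hb2 (hb.comm_x i hij) (hb.comm_c i hij)
  refine slidesAll_of_pair ha.ne (by simpa only [one_smul] using h2) fun l hi hj => ?_
  exact ⟨slides_of_eq (X l) (word_four_comm (ha.comm_x l hi hj) (hb.comm_x l hj))
      (word_four_comm (hb.comm_x l hj) (ha.comm_x l hi hj)),
    slides_of_eq (C l) (word_four_comm (ha.comm_c l hi hj) (hb.comm_c l hj))
      (word_four_comm (hb.comm_c l hj) (ha.comm_c l hi hj))⟩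

/-- The braid relation of type `B_2` with a sign change of the first letter. -/
theorem ReflAt.braid_four_slidesAll' (ha : ReflAt u a X C i j 1) (hb : SignAt 0 b X C i)
    (hij : i ≠ j) (ha2 : a * a = 1) (hb2 : b * b = 1) :
    SlidesAll (b * a * b * a - a * b * a * b) X C := by
  have h1 := ha.refl
  rw [one_smul, one_smul] at h1
  have hs : IsSign 0 b (-X i) (-C i) :=
    ⟨by simp [hb.sign.bx], by simp [hb.sign.bc]⟩
  obtain ⟨⟨hx1, hx2⟩, hc1, hc2⟩ := h1.symm_neg.braid_four_slides hs ha2 hb2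
    (by simpa using hb.comm_x j hij.symm) (by simpa using hb.comm_c j hij.symm)
  refine (slidesAll_of_pair ha.ne
    (by simpa only [one_smul] using ⟨⟨hx2.of_neg, hx1.of_neg⟩, hc2.of_neg, hc1.of_neg⟩)
    fun l hi hj => ?_).sub_comm
  exact ⟨slides_of_eq (X l) (word_four_comm (ha.comm_x l hi hj) (hb.comm_x l hi))
      (word_four_comm (hb.comm_x l hi) (ha.comm_x l hi hj)),
    slides_of_eq (C l) (word_four_comm (ha.comm_c l hi hj) (hb.comm_c l hi))
      (word_four_comm (hb.comm_c l hi) (ha.comm_c l hi hj))⟩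

theorem ReflAt.comm_neg_slidesAll (ha : ReflAt u a X C i j 1) (hb : ReflAt u b X C i j (-1)) :
    SlidesAll (a * b - b * a) X C := by
  have h1 := ha.refl
  rw [one_smul, one_smul] at h1
  have h2 := h1.comm_neg_slides (by simpa using hb.refl)
  refine slidesAll_of_pair ha.ne (by simpa only [one_smul] using h2) fun l hi hj => ?_
  exact ⟨intertwine_slides (hb.comm_x l hi hj) (ha.comm_x l hi hj) (ha.comm_x l hi hj)
      (hb.comm_x l hi hj),
    intertwine_slides (hb.comm_c l hi hj) (ha.comm_c l hi hj) (ha.comm_c l hi hj)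
      (hb.comm_c l hi hj)⟩

/-- An element `p` transforming the letters `X`, `C` into `Y`, `E` intertwines a reflection
on the former with the corresponding reflection on the latter. -/
theorem ReflAt.intertwine_slidesAll (ha : ReflAt u a X C i j ε) (hb : ReflAt u b Y E i j ε)
    (hx : ∀ k, p * X k = Y k * p) (hc : ∀ k, p * C k = E k * p) :
    SlidesAll (p * a - b * p) X C := by
  have h := ha.refl.intertwine_slides hb.refl (hx i)
    (by rw [mul_smul_comm, hx, smul_mul_assoc]) (hc i) (by rw [mul_smul_comm, hc, smul_mul_assoc])
  refine slidesAll_of_pair ha.ne h fun l hi hj => ?_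
  exact ⟨intertwine_slides (ha.comm_x l hi hj) (hx l) (hx l) (hb.comm_x l hi hj),
    intertwine_slides (ha.comm_c l hi hj) (hc l) (hc l) (hb.comm_c l hi hj)⟩

theorem SignAt.intertwine_slidesAll (ha : SignAt v a X C k) (hb : SignAt v b Y E k)
    (hx : ∀ k, p * X k = Y k * p) (hc : ∀ k, p * C k = E k * p) :
    SlidesAll (p * a - b * p) X C := by
  intro l
  by_cases hl : l = k
  · subst hl; exact ha.sign.intertwine_slides hb.sign (hx l) (hc l)
  · exact ⟨intertwine_slides (ha.comm_x l hl) (hx l) (hx l) (hb.comm_x l hl),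
      intertwine_slides (ha.comm_c l hl) (hc l) (hc l) (hb.comm_c l hl)⟩

/-- Reflections moving disjoint sets of letters. -/
theorem ReflAt.disjoint_slidesAll {i' j' : Fin n} {ε' : ℂ} (ha : ReflAt u a X C i j ε)
    (hb : ReflAt u b X C i' j' ε') (h1 : i ≠ i') (h2 : i ≠ j') (h3 : j ≠ i') (h4 : j ≠ j') :
    SlidesAll (a * b - b * a) X C := by
  have ha' := ha.refl.intertwine_slides ha.refl (hb.comm_x i h1 h2) (hb.smul_comm_x ε j h3 h4)
    (hb.comm_c i h1 h2) (hb.smul_comm_c ε j h3 h4)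
  have hb' := hb.refl.intertwine_slides hb.refl (ha.comm_x i' h1.symm h3.symm)
    (ha.smul_comm_x ε' j' h2.symm h4.symm) (ha.comm_c i' h1.symm h3.symm)
    (ha.smul_comm_c ε' j' h2.symm h4.symm)
  refine slidesAll_of_pair hb.ne hb' fun l hi hj => ?_
  rcases PC.eq_or_eq_or_ne l i j with rfl | rfl | ⟨hi', hj'⟩
  · exact ⟨ha'.1.1.sub_comm, ha'.2.1.sub_comm⟩
  · exact ⟨(ha'.1.2.of_smul ha.ne).sub_comm, (ha'.2.2.of_smul ha.ne).sub_comm⟩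
  · exact ⟨intertwine_slides (hb.comm_x l hi hj) (ha.comm_x l hi' hj') (ha.comm_x l hi' hj')
        (hb.comm_x l hi hj),
      intertwine_slides (hb.comm_c l hi hj) (ha.comm_c l hi' hj') (ha.comm_c l hi' hj')
        (hb.comm_c l hi hj)⟩

theorem ReflAt.disjoint_sign_slidesAll (ha : ReflAt u a X C i j ε) (hb : SignAt v b X C k)
    (h1 : i ≠ k) (h2 : j ≠ k) : SlidesAll (a * b - b * a) X C := by
  have ha' := ha.refl.intertwine_slides ha.refl (hb.comm_x i h1)
    (by rw [mul_smul_comm, hb.comm_x j h2, smul_mul_assoc])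
    (hb.comm_c i h1) (by rw [mul_smul_comm, hb.comm_c j h2, smul_mul_assoc])
  have hb' := hb.sign.intertwine_slides hb.sign (ha.comm_x k h1.symm h2.symm)
    (ha.comm_c k h1.symm h2.symm)
  intro l
  by_cases hl : l = k
  · subst hl; exact hb'
  rcases PC.eq_or_eq_or_ne l i j with rfl | rfl | ⟨hi', hj'⟩
  · exact ⟨ha'.1.1.sub_comm, ha'.2.1.sub_comm⟩
  · exact ⟨(ha'.1.2.of_smul ha.ne).sub_comm, (ha'.2.2.of_smul ha.ne).sub_comm⟩
  · exact ⟨intertwine_slides (hb.comm_x l hl) (ha.comm_x l hi' hj') (ha.comm_x l hi' hj')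
        (hb.comm_x l hl),
      intertwine_slides (hb.comm_c l hl) (ha.comm_c l hi' hj') (ha.comm_c l hi' hj')
        (hb.comm_c l hl)⟩

end Families

/-! ### The operators on the induced module -/

/-- The module `A ⊗ ℂ G` for the polynomial-Clifford algebra `A` and a group `G`, realized as the
finitely supported functions `G → A`. -/
def Ind (G : Type*) (n : ℕ) : Type _ := G →₀ PC n

namespace Ind

open PC

variable {n : ℕ} {G : Type*}

instance : AddCommGroup (Ind G n) := inferInstanceAs (AddCommGroup (G →₀ PC n))

instance : Module ℂ (Ind G n) := inferInstanceAs (Module ℂ (G →₀ PC n))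

/-- The map `b ↦ b ⊗ w`. -/
def single (w : G) : PC n →ₗ[ℂ] Ind G n := Finsupp.lsingle w

theorem hom_ext {M : Type*} [AddCommGroup M] [Module ℂ M] {f g : Ind G n →ₗ[ℂ] M}
    (h : ∀ w b, f (single w b) = g (single w b)) : f = g :=
  Finsupp.lhom_ext h

/-- Linear maps on the induced module from their components. -/
def lift {M : Type*} [AddCommGroup M] [Module ℂ M] (f : G → PC n →ₗ[ℂ] M) : Ind G n →ₗ[ℂ] M :=
  Finsupp.lsum ℂ f

@[simp] theorem lift_single {M : Type*} [AddCommGroup M] [Module ℂ M] (f : G → PC n →ₗ[ℂ] M)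
    (w : G) (b : PC n) : lift f (single w b) = f w b :=
  Finsupp.lsum_single ℂ f w b

theorem linearIndependent_single {ι : Type*} {f : ι → PC n} (hf : LinearIndependent ℂ f) :
    LinearIndependent ℂ fun p : Σ _ : G, ι => single p.1 (f p.2) :=
  Finsupp.linearIndependent_single (fun _ => f) fun _ => hf

/-- Left multiplication by elements of the polynomial-Clifford algebra. -/
def L : PC n →ₐ[ℂ] Module.End ℂ (Ind G n) :=
  AlgHom.ofLinearMap
    { toFun := fun a => lift fun w => single w ∘ₗ LinearMap.mulLeft ℂ a
      map_add' := fun a b => hom_ext fun w r => by simp [add_mul]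
      map_smul' := fun s a => hom_ext fun w r => by simp }
    (hom_ext fun w r => by simp)
    (fun a b => hom_ext fun w r => by simp)

@[simp] theorem L_single (a b : PC n) (w : G) :
    L a (single w b) = single w (a * b) := by
  simp [L]

/-- Operators sliding past the letters are determined by their effect on the elements `1 ⊗ w`. -/
theorem eq_of_slidesAll {f g : Module.End ℂ (Ind G n)}
    (h1 : ∀ w, f (single w 1) = g (single w 1))
    (h : SlidesAll (f - g) (fun k => L (x k)) (fun k => L (c k))) : f = g := by
  rw [← sub_eq_zero]
  refine hom_ext fun w b => ?_
  rw [LinearMap.zero_apply]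
  induction b using induction_left with
  | one => simp [h1]
  | add a b ha hb => rw [map_add, map_add, ha, hb, add_zero]
  | smul r a ha => rw [map_smul, map_smul, ha, smul_zero]
  | x_mul i a ha =>
    obtain ⟨z, hz⟩ := (h i).1
    rw [← L_single, ← Module.End.mul_apply, hz, Module.End.mul_apply, ha, map_zero]
  | c_mul i a ha =>
    obtain ⟨z, hz⟩ := (h i).2
    rw [← L_single, ← Module.End.mul_apply, hz, Module.End.mul_apply, ha, map_zero]

variable [Group G]

/-- The operator `b ⊗ w ↦ φ(b) ⊗ g w + D(b) ⊗ w`. -/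
def op (t : Twist n) (g : G) : Module.End ℂ (Ind G n) :=
  lift fun w => single (g * w) ∘ₗ t.hom.toLinearMap + single w ∘ₗ t.der

@[simp] theorem op_single (t : Twist n) (g w : G) (b : PC n) :
    op t g (single w b) = single (g * w) (t.hom b) + single w (t.der b) := by
  simp [op]

theorem op_mul_L (t : Twist n) (g : G) (a : PC n) :
    op t g * L a = L (t.hom a) * op t g + L (t.der a) := by
  refine hom_ext fun w b => ?_
  simp only [Module.End.mul_apply, LinearMap.add_apply, L_single, op_single, map_add, map_mul,
    t.leib]
  abel

end Ind

open PC Ind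

/-! ### The representation on the induced module -/

theorem sigmaIdx_sigmaIdx {n : ℕ} (r : PiIdx) (i : Fin n) : sigmaIdx r (sigmaIdx r i) = i := by
  cases r <;> simp [sigmaIdx]

theorem sigmaSign_mul_self {n : ℕ} (X : WeylType) (r : PiIdx) (i : Fin n) :
    sigmaSign X r i * sigmaSign X r i = 1 := by
  cases X <;> cases r <;> simp only [sigmaSign] <;> split_ifs <;> simp [← mul_pow]

/-- The automorphism of the polynomial-Clifford algebra given by `σ_r`. -/
def sigmaHom {n : ℕ} (X : WeylType) (r : PiIdx) : PC n →ₐ[ℂ] PC n :=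
  signed (sigmaIdx r) (Function.LeftInverse.injective (sigmaIdx_sigmaIdx r)) (sigmaSign X r)
    (sigmaSign_mul_self X r)

section Rep

variable (X : WeylType) (n : ℕ) (u v : ℂ) (hn : 2 ≤ n)

/-- The twist attached to a generator of the extended affine Weyl group. In type `D` that of `s_n`
is conjugate to that of `s_{n-1}` under the sign change of the last letters. -/
def twist : GroupGen X n → Twist n
  | .s i =>
    if h : i.val + 1 < n then .refl u i ⟨i.val + 1, h⟩ (by simp [Fin.ext_iff])
    else match X with
      | .B => .sign ((Real.sqrt 2 : ℂ) * v) i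
      | .D => (Twist.refl u ⟨i.val - 1, by omega⟩ i (by simp [Fin.ext_iff]; omega)).conj (flip i)
          (flip_flip i)
  | .pi r => .ofHom (sigmaHom X r.1)

/-- The operators by which the generators of the extended affine Weyl group act. -/
def gop (g : GroupGen X n) : Module.End ℂ (Ind (We X n) n) :=
  op (twist X n u v hn g) (PresentedGroup.of g)

/-- The operators by which the `x_i` act. -/
def lx (k : Fin n) : Module.End ℂ (Ind (We X n) n) := L (x k)

/-- The operators by which the `c_i` act. -/
def lc (k : Fin n) : Module.End ℂ (Ind (We X n) n) := L (c k)

/-- The action of the free algebra. As `π_r` has order dividing `4`, its inverse can act by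
the third power. -/
def rep : Fr X n →ₐ[ℂ] Module.End ℂ (Ind (We X n) n) :=
  FreeAlgebra.lift ℂ fun
    | .s i => gop X n u v hn (.s i)
    | .pi r => gop X n u v hn (.pi r)
    | .piInv r => gop X n u v hn (.pi r) ^ 3
    | .x i => lx X n i
    | .c i => lc X n i

variable {X n u v hn}

theorem reflAt_s (i j : Fin n) (hij : lab j = lab i + 1) :
    ReflAt u (gop X n u v hn (.s i)) (lx X n) (lc X n) i j 1 := by
  have hj : j = ⟨i.val + 1, by have := j.2; simp [lab] at hij; omega⟩ := by
    simp [lab] at hij; ext; simpa using hij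
  have hi : i.val + 1 < n := by have := j.2; simp [lab] at hij; omega
  have hne : i ≠ j := by rintro rfl; simp [lab] at hij
  have ht : twist X n u v hn (.s i) = .refl u i j hne := by
    have : ∀ h, Twist.refl u i ⟨i.val + 1, hi⟩ h = .refl u i j hne := by
      rw [← hj]; exact fun _ => rfl
    rw [← this (by simp [Fin.ext_iff])]; simp [twist, hi]
  have key : ∀ a, gop X n u v hn (.s i) * L a
      = L ((Twist.refl u i j hne).hom a) * gop X n u v hn (.s i)
        + L ((Twist.refl u i j hne).der a) :=
    fun a => by rw [gop, ht]; exact op_mul_L _ _ a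
  generalize gop X n u v hn (.s i) = T at key ⊢
  refine ⟨⟨?_, ?_, ?_, ?_, ?_⟩, fun k hki hkj => ?_, fun k hki hkj => ?_, one_ne_zero⟩
  · rw [one_smul, lc, lc, ← map_mul, c_anti i j hne, map_neg, map_mul]
  · rw [lx, key]
    simp [Twist.refl, lx, lc, sub_eq_add_neg, add_comm]
  · rw [one_smul, lx, key]
    simp [Twist.refl, lx, lc, hne.symm]
  · rw [lc, key]
    simp [Twist.refl, lc]
  · rw [one_smul, lc, key]
    simp [Twist.refl, lc]
  · rw [lx, key]
    simp [Twist.refl, hki, hkj, Equiv.swap_apply_of_ne_of_ne]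
  · rw [lc, key]
    simp [Twist.refl, hki, hkj, Equiv.swap_apply_of_ne_of_ne]

theorem signAt_last (k : Fin n) (hk : lab k = n) :
    SignAt ((Real.sqrt 2 : ℂ) * v) (gop .B n u v hn (.s k)) (lx .B n) (lc .B n) k := by
  have ht : twist .B n u v hn (.s k) = .sign ((Real.sqrt 2 : ℂ) * v) k := by
    have : ¬ k.val + 1 < n := by simp only [lab] at hk; omega
    simp [twist, this]
  have key : ∀ a, gop .B n u v hn (.s k) * L a
      = L ((Twist.sign ((Real.sqrt 2 : ℂ) * v) k).hom a) * gop .B n u v hn (.s k)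
        + L ((Twist.sign ((Real.sqrt 2 : ℂ) * v) k).der a) :=
    fun a => by rw [gop, ht]; exact op_mul_L _ _ a
  generalize gop .B n u v hn (.s k) = T at key ⊢
  refine ⟨⟨?_, ?_⟩, fun l hl => ?_, fun l hl => ?_⟩
  · rw [lx, key]
    simp [Twist.sign, sub_eq_add_neg]
  · rw [lc, key]
    simp [Twist.sign]
  · rw [lx, key]
    simp [Twist.sign, hl, flip_x hl]
  · rw [lc, key]
    simp [Twist.sign, flip_c hl]

theorem reflAt_last (m k : Fin n) (hm : lab m + 1 = n) (hk : lab k = n) :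
    ReflAt u (gop .D n u v hn (.s k)) (lx .D n) (lc .D n) m k (-1) := by
  have hne : m ≠ k := by rintro rfl; omega
  have ht : twist .D n u v hn (.s k) = (Twist.refl u m k hne).conj (flip k) (flip_flip k) := by
    have h1 : ¬ k.val + 1 < n := by simp only [lab] at hk; omega
    have h2 : m = ⟨k.val - 1, by omega⟩ := by ext; simp only [lab] at hm hk ⊢; omega
    have hk' : k.val - 1 < n := by omega
    have : ∀ h, (Twist.refl u ⟨k.val - 1, hk'⟩ k h).conj (flip k) (flip_flip k)
        = (Twist.refl u m k hne).conj (flip k) (flip_flip k) := by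
      rw [← h2]; exact fun _ => rfl
    rw [← this (h2 ▸ hne)]; simp [twist, h1]
  have key : ∀ a, gop .D n u v hn (.s k) * L a
      = L (((Twist.refl u m k hne).conj (flip k) (flip_flip k)).hom a) * gop .D n u v hn (.s k)
        + L (((Twist.refl u m k hne).conj (flip k) (flip_flip k)).der a) :=
    fun a => by rw [gop, ht]; exact op_mul_L _ _ a
  generalize gop .D n u v hn (.s k) = T at key ⊢
  have fm := flip_x hne
  have fm' := flip_c hne
  refine ⟨⟨?_, ?_, ?_, ?_, ?_⟩, fun l hl hl' => ?_, fun l hl hl' => ?_, by simp⟩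
  · rw [mul_smul_comm, smul_mul_assoc, lc, lc, ← map_mul, c_anti m k hne, map_neg, map_mul,
      smul_neg]
  · rw [lx, key]
    simp [Twist.refl, Twist.conj, lx, lc, sub_eq_add_neg, fm, fm']
  · rw [lx, neg_one_smul, mul_neg, key]
    simp [Twist.refl, Twist.conj, lx, lc, fm, fm', hne.symm, add_comm]
  · rw [lc, key]
    simp [Twist.refl, Twist.conj, lc, fm']
  · rw [neg_one_smul, lc, mul_neg, key]
    simp [Twist.refl, Twist.conj, lc, fm']
  · rw [lx, key]
    simp [Twist.refl, Twist.conj, hl, hl', Equiv.swap_apply_of_ne_of_ne, flip_x]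
  · rw [lc, key]
    simp [Twist.refl, Twist.conj, hl, hl', Equiv.swap_apply_of_ne_of_ne, flip_c]

variable (X n) in
/-- The transforms of the `x_i` under `σ_r`. -/
def sx (r : PiIdx) (k : Fin n) : Module.End ℂ (Ind (We X n) n) := sigmaSign X r k • lx X n (sigmaIdx r k)

variable (X n) in
/-- The transforms of the `c_i` under `σ_r`. -/
def sc (r : PiIdx) (k : Fin n) : Module.End ℂ (Ind (We X n) n) := sigmaSign X r k • lc X n (sigmaIdx r k)

theorem pi_mul_lx (r : OStar X n) (k : Fin n) :
    gop X n u v hn (.pi r) * lx X n k = sx X n r.1 k * gop X n u v hn (.pi r) := by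
  rw [lx, gop, op_mul_L]
  simp [twist, Twist.ofHom, sigmaHom, sx, lx]

theorem pi_mul_lc (r : OStar X n) (k : Fin n) :
    gop X n u v hn (.pi r) * lc X n k = sc X n r.1 k * gop X n u v hn (.pi r) := by
  rw [lc, gop, op_mul_L]
  simp [twist, Twist.ofHom, sigmaHom, sc, lc]

@[simp] theorem rep_x (i : Fin n) : rep X n u v hn (Fr.x i) = lx X n i := by simp [rep, Fr.x]

@[simp] theorem rep_c (i : Fin n) : rep X n u v hn (Fr.c i) = lc X n i := by simp [rep, Fr.c]

@[simp] theorem rep_s (i : Fin n) : rep X n u v hn (Fr.s i) = gop X n u v hn (.s i) := by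
  simp [rep, Fr.s]

@[simp] theorem rep_pi (r : OStar X n) : rep X n u v hn (Fr.pi r) = gop X n u v hn (.pi r) := by
  simp [rep, Fr.pi]

@[simp] theorem rep_piInv (r : OStar X n) :
    rep X n u v hn (Fr.piInv r) = gop X n u v hn (.pi r) ^ 3 := by
  simp [rep, Fr.piInv]

/-- The element of the extended affine Weyl group represented by a positive word. -/
def wordMk : FreeMonoid (GroupGen X n) →* We X n :=
  (PresentedGroup.mk (relators X n)).comp (toFreeGroup X n)

theorem wordMk_eq {a b : FreeMonoid (GroupGen X n)} (h : GroupRel n X a b) :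
    wordMk a = wordMk b := by
  have h1 : PresentedGroup.mk (relators X n) (toFreeGroup X n a * (toFreeGroup X n b)⁻¹) = 1 :=
    PresentedGroup.one_of_mem ⟨a, b, h, rfl⟩
  rwa [map_mul, map_inv, mul_inv_eq_one] at h1

variable (X n u v hn) in
/-- The action of positive words. -/
def wop (a : FreeMonoid (GroupGen X n)) : Module.End ℂ (Ind (We X n) n) :=
  FreeMonoid.lift (gop X n u v hn) a

@[simp] theorem wop_one : wop X n u v hn 1 = 1 := by simp [wop]

@[simp] theorem wop_mul (a b : FreeMonoid (GroupGen X n)) :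
    wop X n u v hn (a * b) = wop X n u v hn a * wop X n u v hn b := by simp [wop]

@[simp] theorem wop_pow (a : FreeMonoid (GroupGen X n)) (k : ℕ) :
    wop X n u v hn (a ^ k) = wop X n u v hn a ^ k := by simp [wop]

@[simp] theorem wop_ws (i : Fin n) : wop X n u v hn (ws i) = gop X n u v hn (.s i) := by
  simp [wop, ws]

@[simp] theorem wop_wp (r : OStar X n) : wop X n u v hn (wp r) = gop X n u v hn (.pi r) := by
  simp [wop, wp]

theorem rep_word (a : FreeMonoid (GroupGen X n)) :
    rep X n u v hn (Fr.word a) = wop X n u v hn a := by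
  have : ((rep X n u v hn : Fr X n →* Module.End ℂ (Ind (We X n) n))).comp Fr.word
      = FreeMonoid.lift (gop X n u v hn) :=
    FreeMonoid.hom_eq fun g => by cases g <;> simp [Fr.word]
  exact DFunLike.congr_fun this a

theorem gop_single_one (g : GroupGen X n) (w : We X n) :
    gop X n u v hn g (Ind.single w 1) = Ind.single (PresentedGroup.of g * w) 1 := by
  simp [gop, Twist.der_one]

theorem wop_single_one (a : FreeMonoid (GroupGen X n)) (w : We X n) :
    wop X n u v hn a (Ind.single w 1) = Ind.single (wordMk a * w) 1 := by
  induction a using FreeMonoid.inductionOn' generalizing w with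
  | one => simp
  | of_mul g a ih =>
    rw [wop_mul, map_mul, Module.End.mul_apply, ih, wop, FreeMonoid.lift_eval_of, gop_single_one,
      mul_assoc]
    rfl

/-- Two words representing the same element of `W^e` agree on all `1 ⊗ w`, so that their operators
coincide as soon as the difference can be moved past every generator of `A`. -/
theorem wop_eq {a b : FreeMonoid (GroupGen X n)} (hab : wordMk a = wordMk b)
    (h : SlidesAll (wop X n u v hn a - wop X n u v hn b) (lx X n) (lc X n)) :
    wop X n u v hn a = wop X n u v hn b :=
  eq_of_slidesAll (fun w => by rw [wop_single_one, wop_single_one, hab]) h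

end Rep

/-! ### The relations of the extended affine Weyl group -/

section Transform

variable {R : Type*} [Ring R] [Algebra ℂ R] {n : ℕ} {u : ℂ} {X C : Fin n → R} {b : R}
  {i j i' j' : Fin n} {ε ε' : ℂ} {f : Fin n → Fin n} {t : Fin n → ℂ}

theorem ReflAt.transform_of_refl (hb : ReflAt u b X C i' j' ε')
    (h : IsRefl u b (t i • X (f i)) (ε • t j • X (f j)) (t i • C (f i)) (ε • t j • C (f j)))
    (hε : ε ≠ 0) (hf : ∀ k, k ≠ i → k ≠ j → f k ≠ i' ∧ f k ≠ j') :
    ReflAt u b (fun k => t k • X (f k)) (fun k => t k • C (f k)) i j ε where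
  refl := h
  comm_x k hi hj := hb.smul_comm_x _ _ (hf k hi hj).1 (hf k hi hj).2
  comm_c k hi hj := hb.smul_comm_c _ _ (hf k hi hj).1 (hf k hi hj).2
  ne := hε

/-- Transformation of a reflection under a signed permutation preserving the order of
the two letters. -/
theorem ReflAt.transform (hb : ReflAt u b X C i' j' ε') (hf : f.Injective) (hi : f i = i')
    (hj : f j = j') (hti : t i = 1) (htj : ε * t j = ε') (hε : ε ≠ 0) :
    ReflAt u b (fun k => t k • X (f k)) (fun k => t k • C (f k)) i j ε := by
  refine hb.transform_of_refl ?_ hε fun k hki hkj =>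
    ⟨fun h => hki (hf (h.trans hi.symm)), fun h => hkj (hf (h.trans hj.symm))⟩
  rw [smul_smul, smul_smul, hi, hj, hti, htj, one_smul, one_smul]
  exact hb.refl

/-- Transformation of a reflection under a signed permutation reversing the order of
the two letters. -/
theorem ReflAt.transform_rev (hb : ReflAt u b X C i' j' ε') (hf : f.Injective) (hi : f i = j')
    (hj : f j = i') (hti : t i = -ε') (htj : ε * t j = -1) (hε : ε ≠ 0) :
    ReflAt u b (fun k => t k • X (f k)) (fun k => t k • C (f k)) i j ε := by
  refine hb.transform_of_refl ?_ hε fun k hki hkj =>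
    ⟨fun h => hkj (hf (h.trans hj.symm)), fun h => hki (hf (h.trans hi.symm))⟩
  rw [smul_smul, smul_smul, hi, hj, hti, htj, neg_one_smul, neg_one_smul, neg_smul, neg_smul]
  exact hb.refl.symm_neg

theorem conj_comm {R : Type*} [Ring R] {p a x y : R} (h1 : p * x = y * p) (h2 : a * y = y * a)
    (h3 : p * y = x * p) : p * a * p * x = x * (p * a * p) := by
  simp only [mul_assoc, h1, mul_mul_eq h2, mul_mul_eq h3]

/-- Let `p` change the signs `t` of the letters, where `t` is `-1` at `i` and `1` at `j`, and let `q`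
send the letters to the negatives of their permutation by `f`, where `f` maps `i`, `j` to `k`, `m`.
Then the conjugates by `p` and `q` of the reflections in `e_i - e_j` and `e_m + e_k`
are both the reflection in `e_i + e_j`. -/
theorem ReflAt.conj_slidesAll {a p q : R} {m k : Fin n} (ra : ReflAt u a X C i j 1)
    (rb : ReflAt u b X C m k (-1)) (hP : p * p = 1) (hQ : q * q = 1)
    (px : ∀ l, p * X l = t l • X l * p) (pc : ∀ l, p * C l = t l • C l * p)
    (qx : ∀ l, q * X l = -X (f l) * q) (qc : ∀ l, q * C l = -C (f l) * q)
    (ht : ∀ l, t l * t l = 1) (hf : ∀ l, f (f l) = l) (hi : t i = -1) (hj : t j = 1)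
    (hik : f i = k) (hjm : f j = m) : SlidesAll (p * a * p - q * b * q) X C := by
  have h1 := ra.refl
  rw [one_smul, one_smul] at h1
  have h2 := rb.refl
  rw [neg_one_smul, neg_one_smul] at h2
  have hF := h1.conj hP (x' := -X i) (y' := X j) (c' := -C i) (d' := C j)
    (by rw [neg_mul, h1.anti, mul_neg])
    (by rw [mul_neg, px, hi, neg_one_smul, neg_mul, neg_neg]) (by rw [px, hj, one_smul])
    (by rw [mul_neg, pc, hi, neg_one_smul, neg_mul, neg_neg]) (by rw [pc, hj, one_smul])
  have hG := (h2.conj hQ (x' := -X j) (y' := X i) (c' := -C j) (d' := C i)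
    (by rw [neg_mul, mul_neg, h1.anti, neg_neg])
    (by rw [mul_neg, qx, hjm, neg_mul, neg_neg]) (by rw [qx, hik])
    (by rw [mul_neg, qc, hjm, neg_mul, neg_neg]) (by rw [qc, hik])).symm_neg
  rw [neg_neg, neg_neg] at hG
  obtain ⟨⟨hx1, hx2⟩, hc1, hc2⟩ := hF.sub_slides hG
  refine slidesAll_of_pair one_ne_zero
    ⟨⟨hx1.of_neg, by rwa [one_smul]⟩, hc1.of_neg, by rwa [one_smul]⟩ fun l hl hl' => ?_
  have hlk : f l ≠ k := fun h => hl (by rw [← hf l, h, ← hik, hf])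
  have hlm : f l ≠ m := fun h => hl' (by rw [← hf l, h, ← hjm, hf])
  refine ⟨slides_of_eq (X l) (conj_comm (px l) (ra.smul_comm_x _ l hl hl') ?_)
    (conj_comm (qx l) ?_ ?_),
    slides_of_eq (C l) (conj_comm (pc l) (ra.smul_comm_c _ l hl hl') ?_) (conj_comm (qc l) ?_ ?_)⟩
  · rw [mul_smul_comm, px, smul_mul_assoc, smul_smul, ht, one_smul]
  · rw [mul_neg, rb.comm_x _ hlm hlk, neg_mul]
  · rw [mul_neg, qx, hf, neg_mul, neg_neg]
  · rw [mul_smul_comm, pc, smul_mul_assoc, smul_smul, ht, one_smul]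
  · rw [mul_neg, rb.comm_c _ hlm hlk, neg_mul]
  · rw [mul_neg, qc, hf, neg_mul, neg_neg]

end Transform

section Labels

variable {n : ℕ}

theorem lab_injective {i j : Fin n} (h : lab i = lab j) : i = j := by
  ext; simpa [lab] using h

theorem lab_pos (i : Fin n) : 1 ≤ lab i := by simp [lab]

theorem lab_le (i : Fin n) : lab i ≤ n := i.2

theorem exists_lab_succ (i : Fin n) (h : lab i < n) : ∃ j : Fin n, lab j = lab i + 1 :=
  ⟨⟨i.val + 1, h⟩, rfl⟩

theorem exists_lab_pred (k : Fin n) (h : 2 ≤ lab k) : ∃ m : Fin n, lab m + 1 = lab k :=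
  ⟨⟨k.val - 1, by omega⟩, by simp only [lab] at h ⊢; omega⟩

theorem lab_sigmaIdx_last (i : Fin n) : lab (sigmaIdx .last i) + lab i = n + 1 := by
  simp only [sigmaIdx, lab, Fin.val_rev]; omega

theorem sigmaIdx_injective (r : PiIdx) : (sigmaIdx r : Fin n → Fin n).Injective :=
  Function.LeftInverse.injective (sigmaIdx_sigmaIdx r)

theorem sigmaSign_first_D (i : Fin n) (h1 : lab i ≠ 1) (hn : lab i ≠ n) :
    sigmaSign .D .first i = 1 := by simp [sigmaSign, h1, hn]

theorem sigmaSign_last_D (i : Fin n) (hn : lab i ≠ n) : sigmaSign .D .last i = -1 := by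
  simp [sigmaSign, hn]

theorem sigmaSign_last_D_even (he : Even n) (l : Fin n) : sigmaSign .D .last l = -1 := by
  by_cases h : lab l = n
  · have := lab_pos l
    simp [sigmaSign, h, (Nat.Even.sub_odd (by omega) he odd_one).neg_one_pow]
  · exact sigmaSign_last_D l h

end Labels

section Relations

variable {X : WeylType} {n : ℕ} {u v : ℂ} {hn : 2 ≤ n}

theorem gop_s_sq (i : Fin n) : gop X n u v hn (.s i) * gop X n u v hn (.s i) = 1 := by
  have h : SlidesAll (gop X n u v hn (.s i) * gop X n u v hn (.s i) - 1) (lx X n) (lc X n) := by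
    by_cases hi : lab i < n
    · obtain ⟨j, hj⟩ := exists_lab_succ i hi
      exact (reflAt_s i j hj).sq_slidesAll
    · have hi' : lab i = n := le_antisymm (lab_le i) (not_lt.1 hi)
      cases X with
      | B => exact (signAt_last i hi').sq_slidesAll
      | D =>
        obtain ⟨m, hm⟩ := exists_lab_pred i (by omega)
        exact (reflAt_last m i (hm.trans hi') hi').sq_slidesAll
  simpa using wop_eq (u := u) (v := v) (hn := hn) (wordMk_eq (GroupRel.invol X i))
    (by simpa using h)

theorem pi_pi_mul_lx (p q : OStar X n) (k : Fin n) :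
    gop X n u v hn (.pi p) * gop X n u v hn (.pi q) * lx X n k =
      ((sigmaSign X q.1 k * sigmaSign X p.1 (sigmaIdx q.1 k)) •
        lx X n (sigmaIdx p.1 (sigmaIdx q.1 k))) *
        (gop X n u v hn (.pi p) * gop X n u v hn (.pi q)) := by
  rw [mul_assoc, pi_mul_lx, sx, smul_mul_assoc, mul_smul_comm, ← mul_assoc, pi_mul_lx, sx,
    smul_mul_assoc, smul_mul_assoc, smul_mul_assoc, smul_smul, mul_assoc]

theorem pi_pi_mul_lc (p q : OStar X n) (k : Fin n) :
    gop X n u v hn (.pi p) * gop X n u v hn (.pi q) * lc X n k =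
      ((sigmaSign X q.1 k * sigmaSign X p.1 (sigmaIdx q.1 k)) •
        lc X n (sigmaIdx p.1 (sigmaIdx q.1 k))) *
        (gop X n u v hn (.pi p) * gop X n u v hn (.pi q)) := by
  rw [mul_assoc, pi_mul_lc, sc, smul_mul_assoc, mul_smul_comm, ← mul_assoc, pi_mul_lc, sc,
    smul_mul_assoc, smul_mul_assoc, smul_mul_assoc, smul_smul, mul_assoc]

/-- Conjugation of a reflection by an element `p` whose image transforms the letters by `σ_r`. -/
theorem pi_refl_slidesAll (p : OStar X n) {a b : Module.End ℂ (Ind (We X n) n)} {i j : Fin n}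
    {ε : ℂ} (ha : ReflAt u a (lx X n) (lc X n) i j ε)
    (hb : ReflAt u b (sx X n p.1) (sc X n p.1) i j ε) :
    SlidesAll (gop X n u v hn (.pi p) * a - b * gop X n u v hn (.pi p)) (lx X n) (lc X n) :=
  ha.intertwine_slidesAll hb (pi_mul_lx p) (pi_mul_lc p)

theorem pi_sq_eq_one (p : OStar X n)
    (h : ∀ k : Fin n, sigmaSign X p.1 k * sigmaSign X p.1 (sigmaIdx p.1 k) = 1)
    (hp : wordMk (wp p * wp p) = 1) :
    gop X n u v hn (.pi p) * gop X n u v hn (.pi p) = 1 := by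
  have h' : SlidesAll (gop X n u v hn (.pi p) * gop X n u v hn (.pi p) - 1) (lx X n) (lc X n) :=
    fun k => ⟨slides_of_eq (lx X n k) (by rw [pi_pi_mul_lx, h, one_smul, sigmaIdx_sigmaIdx])
        (by simp),
      slides_of_eq (lc X n k) (by rw [pi_pi_mul_lc, h, one_smul, sigmaIdx_sigmaIdx]) (by simp)⟩
  simpa using wop_eq (u := u) (v := v) (hn := hn) (a := wp p * wp p) (b := 1)
    (by rw [hp, map_one]) (by simpa using h')

theorem pi_four (p : OStar X n) (hp : wordMk (wp p ^ 4) = 1) :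
    gop X n u v hn (.pi p) ^ 4 = 1 := by
  set P := gop X n u v hn (.pi p) with hP
  have hs : ∀ k : Fin n, (sigmaSign X p.1 k * sigmaSign X p.1 (sigmaIdx p.1 k)) *
      (sigmaSign X p.1 k * sigmaSign X p.1 (sigmaIdx p.1 k)) = 1 := fun k => by
    rw [mul_mul_mul_comm, sigmaSign_mul_self, sigmaSign_mul_self, one_mul]
  have h4 : P ^ 4 = P * P * (P * P) := by rw [pow_succ, pow_succ, pow_two]; simp only [mul_assoc]
  have h' : SlidesAll (P ^ 4 - 1) (lx X n) (lc X n) := by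
    rw [h4]
    refine fun k => ⟨slides_of_eq (lx X n k) ?_ (by simp), slides_of_eq (lc X n k) ?_ (by simp)⟩
    · rw [mul_assoc, hP, pi_pi_mul_lx, sigmaIdx_sigmaIdx, smul_mul_assoc, mul_smul_comm,
        ← mul_assoc _ (lx X n k), pi_pi_mul_lx, sigmaIdx_sigmaIdx, smul_mul_assoc, smul_mul_assoc,
        smul_smul, hs, one_smul, mul_assoc]
    · rw [mul_assoc, hP, pi_pi_mul_lc, sigmaIdx_sigmaIdx, smul_mul_assoc, mul_smul_comm,
        ← mul_assoc _ (lc X n k), pi_pi_mul_lc, sigmaIdx_sigmaIdx, smul_mul_assoc, smul_mul_assoc,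
        smul_smul, hs, one_smul, mul_assoc]
  have e := wop_eq (u := u) (v := v) (hn := hn) (a := wp p ^ 4) (b := 1) (by rw [hp, map_one])
    (by rw [wop_pow, wop_wp, wop_one]; exact h')
  rwa [wop_pow, wop_wp, wop_one] at e

theorem sigmaSign_D_even (he : Even n) (r : PiIdx) (k : Fin n) :
    sigmaSign .D r k * sigmaSign .D r (sigmaIdx r k) = 1 := by
  cases r with
  | first => exact sigmaSign_mul_self _ _ _
  | last =>
    simp only [sigmaSign_last_D_even he]; simp

/-- The relations exchanging the simple reflections with labels `i` and `n - i`. -/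
theorem pi_last_slidesAll (q : OStar .D n) (hq : q.1 = .last) (i j : Fin n)
    (hi : lab i + 2 ≤ n) (hj : lab i + lab j = n) :
    SlidesAll (gop .D n u v hn (.pi q) * gop .D n u v hn (.s i) -
      gop .D n u v hn (.s j) * gop .D n u v hn (.pi q)) (lx .D n) (lc .D n) := by
  obtain ⟨i₂, hi₂⟩ := exists_lab_succ i (by omega)
  obtain ⟨j₂, hj₂⟩ := exists_lab_succ j (by have := lab_pos i; omega)
  refine pi_refl_slidesAll q (reflAt_s i i₂ hi₂) ?_
  rw [hq]
  have e1 := lab_sigmaIdx_last i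
  have e2 := lab_sigmaIdx_last i₂
  exact (reflAt_s j j₂ hj₂).transform_rev (sigmaIdx_injective _) (lab_injective (by omega))
    (lab_injective (by omega)) (sigmaSign_last_D i (by omega))
    (by rw [sigmaSign_last_D i₂ (by omega), one_mul]) one_ne_zero

theorem wop_braid (i j : Fin n) (hij : lab j = lab i + 1) (hj : lab j < n) :
    wop X n u v hn (ws i * ws j * ws i) = wop X n u v hn (ws j * ws i * ws j) := by
  have hw := wordMk_eq (GroupRel.braid X i j hij hj)
  obtain ⟨k, hk⟩ := exists_lab_succ j hj
  refine wop_eq hw ?_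
  simp only [wop_mul, wop_ws]
  exact (reflAt_s i j hij).braid_slidesAll (reflAt_s j k hk) (by rintro rfl; omega)
    (by rintro rfl; omega) (by rintro rfl; omega) (gop_s_sq i) (gop_s_sq j)

theorem wop_comm (i j : Fin n) (hij : lab i + 1 < lab j) (hj : lab j < n) :
    wop X n u v hn (ws i * ws j) = wop X n u v hn (ws j * ws i) := by
  have hw := wordMk_eq (GroupRel.comm X i j hij hj)
  obtain ⟨i₂, hi₂⟩ := exists_lab_succ i (by omega)
  obtain ⟨j₂, hj₂⟩ := exists_lab_succ j hj
  refine wop_eq hw ?_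
  simp only [wop_mul, wop_ws]
  exact (reflAt_s i i₂ hi₂).disjoint_slidesAll (reflAt_s j j₂ hj₂) (by rintro rfl; omega)
    (by rintro rfl; omega) (by rintro rfl; omega) (by rintro rfl; omega)

theorem wop_braid_last_B (m k : Fin n) (hm : lab m + 1 = n) (hk : lab k = n) :
    wop .B n u v hn ((ws m * ws k) ^ 4) = wop .B n u v hn (1) := by
  have hw := wordMk_eq (GroupRel.braid_last_B m k hm hk)
  have hr := reflAt_s (u := u) (v := v) (hn := hn) (X := .B) m k (by omega)
  have hmk : m ≠ k := by rintro rfl; omega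
  have hs := gop_s_sq (u := u) (v := v) (hn := hn) (X := .B)
  have hS := hr.braid_four_slidesAll (signAt_last k hk) hmk (hs m) (hs k)
  -- The relation `(s_m s_k)^4 = 1` is equivalent to the braid relation of length four.
  have hw2 : wordMk (X := .B) (ws m * ws k * ws m * ws k)
      = wordMk (ws k * ws m * ws k * ws m) := by
    have hm2 := wordMk_eq (GroupRel.invol (n := n) .B m)
    have hk2 := wordMk_eq (GroupRel.invol (n := n) .B k)
    simp only [map_mul, map_one, map_pow] at hm2 hk2 hw ⊢
    generalize wordMk (X := .B) (ws m) = s at *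
    generalize wordMk (X := .B) (ws k) = t at *
    have h1 : s * t * s * t * (s * t * s * t) = 1 := by
      rw [← hw, pow_succ, pow_succ, pow_two]; simp only [mul_assoc]
    have h2 : t * s * t * s = (s * t * s * t)⁻¹ := by
      rw [mul_inv_rev, mul_inv_rev, mul_inv_rev, eq_comm, inv_eq_of_mul_eq_one_left hm2,
        inv_eq_of_mul_eq_one_left hk2]
      simp only [mul_assoc]
    rw [h2]; exact eq_inv_of_mul_eq_one_left h1
  have h4 := wop_eq (u := u) (v := v) (hn := hn) hw2 (by simpa only [wop_mul, wop_ws] using hS)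
  simp only [wop_mul, wop_ws] at h4
  rw [wop_pow, wop_mul, wop_ws, wop_ws, wop_one]
  have hm2 := hs m
  have hk2 := hs k
  generalize gop .B n u v hn (.s m) = s at *
  generalize gop .B n u v hn (.s k) = t at *
  calc (s * t) ^ 4 = s * t * s * t * (s * t * s * t) := by
        rw [pow_succ, pow_succ, pow_two]; simp only [mul_assoc]
    _ = s * t * s * t * (t * s * t * s) := by rw [h4]
    _ = 1 := by simp only [mul_assoc, mul_mul_eq hk2, mul_mul_eq hm2, hm2, one_mul]

theorem wop_pi_s_B (p : OStar .B n) (i : Fin n) (hi : 2 ≤ lab i) :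
    wop .B n u v hn (wp p * ws i) = wop .B n u v hn (ws i * wp p) := by
  have hw := wordMk_eq (GroupRel.pi_s_B p i hi)
  have hp : p.1 = .first := p.2
  refine wop_eq hw ?_
  simp only [wop_mul, wop_ws, wop_wp]
  by_cases hi' : lab i < n
  · obtain ⟨i₂, hi₂⟩ := exists_lab_succ i hi'
    refine pi_refl_slidesAll p (reflAt_s i i₂ hi₂) ?_
    rw [hp]
    exact (reflAt_s i i₂ hi₂).transform (sigmaIdx_injective _) rfl rfl
      (if_neg (by omega)) (by rw [one_mul]; exact if_neg (by omega)) one_ne_zero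
  · have hin : lab i = n := le_antisymm (lab_le i) (not_lt.1 hi')
    have hs := signAt_last (u := u) (v := v) (hn := hn) i hin
    have h1 : sigmaSign .B .first i = 1 := if_neg (by omega)
    refine hs.intertwine_slidesAll (Y := sx .B n p.1) (E := sc .B n p.1) ?_ (pi_mul_lx p)
      (pi_mul_lc p)
    rw [hp]
    refine ⟨?_, fun l hl => ?_, fun l hl => ?_⟩
    · rw [sx, sc, h1, one_smul, one_smul]; exact hs.sign
    · rw [sx, mul_smul_comm, smul_mul_assoc]; congr 1; exact hs.comm_x l hl
    · rw [sc, mul_smul_comm, smul_mul_assoc]; congr 1; exact hs.comm_c l hl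

theorem wop_pi_s_one_B (p : OStar .B n) (i : Fin n) (hi : lab i = 1) :
    wop .B n u v hn (wp p * ws i * wp p * ws i) = wop .B n u v hn (ws i * wp p * ws i * wp p) := by
  have hw := wordMk_eq (GroupRel.pi_s_one_B p i hi)
  have hp : p.1 = .first := p.2
  obtain ⟨j, hj⟩ := exists_lab_succ i (by omega)
  have hs : sigmaSign .B .first i = -1 := if_pos hi
  have hP : gop .B n u v hn (.pi p) * gop .B n u v hn (.pi p) = 1 := by
    have hw2 := wordMk_eq (GroupRel.pi_sq_B p)
    rw [pow_two] at hw2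
    refine pi_sq_eq_one p (fun k => ?_) (hw2.trans (map_one _))
    rw [hp]; exact sigmaSign_mul_self _ _ _
  refine wop_eq hw ?_
  simp only [wop_mul, wop_ws, wop_wp]
  refine (reflAt_s i j hj).braid_four_slidesAll' ?_ (by rintro rfl; omega) (gop_s_sq i) hP
  refine ⟨⟨?_, ?_⟩, fun l hl => ?_, fun l hl => ?_⟩
  · rw [pi_mul_lx, sx, hp, hs, neg_one_smul, neg_mul, zero_smul, sub_zero]; rfl
  · rw [pi_mul_lc, sc, hp, hs, neg_one_smul, neg_mul]; rfl
  · have hl' : sigmaSign .B .first l = 1 := if_neg fun h => hl (lab_injective (h.trans hi.symm))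
    rw [pi_mul_lx, sx, hp, hl', one_smul]; rfl
  · have hl' : sigmaSign .B .first l = 1 := if_neg fun h => hl (lab_injective (h.trans hi.symm))
    rw [pi_mul_lc, sc, hp, hl', one_smul]; rfl

theorem wop_comm_last_D (i k : Fin n) (hi : lab i + 2 ≠ n) (hk : lab k = n) :
    wop .D n u v hn (ws i * ws k) = wop .D n u v hn (ws k * ws i) := by
  have hw := wordMk_eq (GroupRel.comm_last_D i k hi hk)
  by_cases hik : i = k
  · subst hik; rfl
  obtain ⟨m, hm⟩ := exists_lab_pred k (by omega)
  rw [hk] at hm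
  have hi' : lab i < n := lt_of_le_of_ne (lab_le i) fun h => hik (lab_injective (h.trans hk.symm))
  refine wop_eq hw ?_
  simp only [wop_mul, wop_ws]
  by_cases him : i = m
  · subst him
    exact (reflAt_s i k (by omega)).comm_neg_slidesAll (reflAt_last i k hm hk)
  · have him' : lab i ≠ lab m := fun h => him (lab_injective h)
    obtain ⟨i₂, hi₂⟩ := exists_lab_succ i hi'
    exact (reflAt_s i i₂ hi₂).disjoint_slidesAll (reflAt_last m k hm hk) him hik
      (by rintro rfl; omega) (by rintro rfl; omega)

theorem wop_pi_sq_s_D (h4 : 4 ≤ n) (ho : Odd n) (q : OStar .D n) (hq : q.1 = .last) (m k : Fin n)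
    (hm : lab m + 1 = n) (hk : lab k = n) :
    wop .D n u v hn (wp q ^ 2 * ws m) = wop .D n u v hn (ws k * wp q ^ 2) := by
  have hw := wordMk_eq (GroupRel.pi_sq_s_D ho q hq m k hm hk)
  refine wop_eq hw ?_
  simp only [wop_mul, wop_ws, wop_wp, pow_two]
  have h1 : ∀ l : Fin n, sigmaIdx q.1 (sigmaIdx q.1 l) = l := sigmaIdx_sigmaIdx q.1
  refine (reflAt_s m k (by omega)).intertwine_slidesAll ?_ (pi_pi_mul_lx q q)
    (pi_pi_mul_lc q q)
  have em := lab_sigmaIdx_last m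
  have ek := lab_sigmaIdx_last k
  refine (reflAt_last m k hm hk).transform
    (t := fun l => sigmaSign .D q.1 l * sigmaSign .D q.1 (sigmaIdx q.1 l))
    (f := fun l => sigmaIdx q.1 (sigmaIdx q.1 l))
    ((sigmaIdx_injective _).comp (sigmaIdx_injective _)) (h1 m) (h1 k) ?_ ?_ one_ne_zero
  · simp only [hq]
    rw [sigmaSign_last_D m (by omega), sigmaSign_last_D _ (by omega)]; norm_num
  · have hs : sigmaSign .D .last k = 1 := by
      simp [sigmaSign, hk, (Nat.Odd.sub_odd ho odd_one).neg_one_pow]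
    simp only [hq]
    rw [hs, sigmaSign_last_D _ (by omega)]; norm_num

theorem wop_pi_s_last_D (ho : Odd n) (q : OStar .D n) (hq : q.1 = .last) (i k : Fin n)
    (hi : lab i = 1) (hk : lab k = n) :
    wop .D n u v hn (wp q * ws k) = wop .D n u v hn (ws i * wp q) := by
  have hw := wordMk_eq (GroupRel.pi_s_last_D ho q hq i k hi hk)
  obtain ⟨m, hm⟩ := exists_lab_pred k (by omega)
  rw [hk] at hm
  obtain ⟨i₂, hi₂⟩ := exists_lab_succ i (by omega)
  refine wop_eq hw ?_
  simp only [wop_mul, wop_ws, wop_wp]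
  refine pi_refl_slidesAll q (reflAt_last m k hm hk) ?_
  rw [hq]
  have em := lab_sigmaIdx_last m
  have ek := lab_sigmaIdx_last k
  have hs : sigmaSign .D .last k = 1 := by
    simp [sigmaSign, hk, (Nat.Odd.sub_odd ho odd_one).neg_one_pow]
  exact (reflAt_s i i₂ hi₂).transform_rev (sigmaIdx_injective _) (lab_injective (by omega))
    (lab_injective (by omega)) (sigmaSign_last_D m (by omega)) (by rw [hs, mul_one]) (by simp)

theorem wop_pi_comm_D (he : Even n) (p q : OStar .D n) (hp : p.1 = .first) (hq : q.1 = .last) :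
    wop .D n u v hn (wp p * wp q) = wop .D n u v hn (wp q * wp p) := by
  have hw := wordMk_eq (GroupRel.pi_comm_D he p q hp hq)
  refine wop_eq hw ?_
  simp only [wop_mul, wop_wp]
  have hfirst : ∀ l : Fin n, sigmaSign .D .first (sigmaIdx .last l) = sigmaSign .D .first l :=
    fun l => by
      have := lab_sigmaIdx_last l
      simp only [sigmaSign]
      congr 1
      exact propext ⟨fun h => by omega, fun h => by omega⟩
  refine fun k => ⟨slides_of_eq _ (pi_pi_mul_lx p q k) ?_, slides_of_eq _ (pi_pi_mul_lc p q k) ?_⟩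
  · rw [pi_pi_mul_lx, hp, hq, sigmaSign_last_D_even he,
      sigmaSign_last_D_even he, hfirst, mul_comm]; rfl
  · rw [pi_pi_mul_lc, hp, hq, sigmaSign_last_D_even he,
      sigmaSign_last_D_even he, hfirst, mul_comm]; rfl

theorem wop_pi_conj_D (h4 : 4 ≤ n) (he : Even n) (p q : OStar .D n) (hp : p.1 = .first)
    (hq : q.1 = .last) (i k : Fin n) (hi : lab i = 1) (hk : lab k = n) :
    wop .D n u v hn (wp p * ws i * wp p) = wop .D n u v hn (wp q * ws k * wp q) := by
  have hw := wordMk_eq (GroupRel.pi_conj_D he p q hp hq i k hi hk)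
  obtain ⟨i₂, hi₂⟩ := exists_lab_succ i (by omega)
  obtain ⟨m, hm⟩ := exists_lab_pred k (by omega)
  rw [hk] at hm
  have hP := pi_sq_eq_one (u := u) (v := v) (hn := hn) p (sigmaSign_D_even he p.1)
    (by have := wordMk_eq (GroupRel.pi_sq_D he p); rwa [pow_two, map_one] at this)
  have hQ := pi_sq_eq_one (u := u) (v := v) (hn := hn) q (sigmaSign_D_even he q.1)
    (by have := wordMk_eq (GroupRel.pi_sq_D he q); rwa [pow_two, map_one] at this)
  have ei := lab_sigmaIdx_last i
  have ei₂ := lab_sigmaIdx_last i₂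
  refine wop_eq hw ?_
  simp only [wop_mul, wop_ws, wop_wp]
  refine (reflAt_s i i₂ hi₂).conj_slidesAll (reflAt_last m k hm hk) hP hQ
    (t := sigmaSign .D .first) (f := sigmaIdx .last) (fun l => ?_) (fun l => ?_) (fun l => ?_)
    (fun l => ?_) (sigmaSign_mul_self _ _) (sigmaIdx_sigmaIdx _) (if_pos (Or.inl hi))
    (sigmaSign_first_D i₂ (by omega) (by omega)) (lab_injective (by omega))
    (lab_injective (by omega))
  · rw [pi_mul_lx, hp]; rfl
  · rw [pi_mul_lc, hp]; rfl
  · rw [pi_mul_lx, sx, hq, sigmaSign_last_D_even he, neg_one_smul]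
  · rw [pi_mul_lc, sc, hq, sigmaSign_last_D_even he, neg_one_smul]

/-- The operators on the induced module satisfy the relations of `W^e` in type `B_n`. -/
theorem wop_group_B {a b : FreeMonoid (GroupGen .B n)} (h : GroupRel n .B a b) :
    wop .B n u v hn a = wop .B n u v hn b := by
  have hw := wordMk_eq h
  cases h with
  | invol _ i => rw [wop_mul, wop_ws, wop_one, gop_s_sq]
  | braid _ i j hij hj => exact wop_braid i j hij hj
  | comm _ i j hij hj => exact wop_comm i j hij hj
  | comm_last_B i k hi hk =>
    obtain ⟨i₂, hi₂⟩ := exists_lab_succ i (by omega)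
    refine wop_eq hw ?_
    simp only [wop_mul, wop_ws]
    exact (reflAt_s i i₂ hi₂).disjoint_sign_slidesAll (signAt_last k hk) (by rintro rfl; omega)
      (by rintro rfl; omega)
  | braid_last_B m k hm hk => exact wop_braid_last_B m k hm hk
  | pi_sq_B p =>
    have hp : p.1 = .first := p.2
    rw [pow_two] at hw
    rw [wop_pow, wop_wp, wop_one, pow_two]
    refine pi_sq_eq_one p (fun k => ?_) (hw.trans (map_one _))
    rw [hp]; exact sigmaSign_mul_self _ _ _
  | pi_s_B p i hi => exact wop_pi_s_B p i hi
  | pi_s_one_B p i hi => exact wop_pi_s_one_B p i hi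

/-- The operators on the induced module satisfy the relations of `W^e` in type `D_n`. -/
theorem wop_group_D (h4 : 4 ≤ n) {a b : FreeMonoid (GroupGen .D n)} (h : GroupRel n .D a b) :
    wop .D n u v hn a = wop .D n u v hn b := by
  have hw := wordMk_eq h
  cases h with
  | invol _ i => rw [wop_mul, wop_ws, wop_one, gop_s_sq]
  | braid _ i j hij hj => exact wop_braid i j hij hj
  | comm _ i j hij hj => exact wop_comm i j hij hj
  | comm_last_D i k hi hk => exact wop_comm_last_D i k hi hk
  | braid_last_D l k hl hk =>
    obtain ⟨m, hm⟩ := exists_lab_pred k (by omega)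
    rw [hk] at hm
    refine wop_eq hw ?_
    simp only [wop_mul, wop_ws]
    exact (reflAt_s l m (by omega)).braid_slidesAll (reflAt_last m k hm hk) (by rintro rfl; omega)
      (by rintro rfl; omega) (by rintro rfl; omega) (gop_s_sq l) (gop_s_sq k)
  | pi_four_D ho q hq =>
    rw [wop_pow, wop_wp, wop_one]
    exact pi_four q (hw.trans (map_one _))
  | pi_sq_s_D ho q hq m k hm hk => exact wop_pi_sq_s_D h4 ho q hq m k hm hk
  | pi_s_D ho q hq i j hi hj =>
    refine wop_eq hw ?_
    simp only [wop_mul, wop_ws, wop_wp]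
    exact pi_last_slidesAll q hq i j hi hj
  | pi_s_last_D ho q hq i k hi hk => exact wop_pi_s_last_D ho q hq i k hi hk
  | pi_sq_D he p =>
    rw [pow_two] at hw
    rw [wop_pow, wop_wp, wop_one, pow_two]
    exact pi_sq_eq_one p (sigmaSign_D_even he p.1) (hw.trans (map_one _))
  | pi_comm_D he p q hp hq => exact wop_pi_comm_D he p q hp hq
  | pi_conj_D he p q hp hq i k hi hk => exact wop_pi_conj_D h4 he p q hp hq i k hi hk
  | pi_one_s_D he p hp i hi hi' =>
    obtain ⟨i₂, hi₂⟩ := exists_lab_succ i (by omega)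
    refine wop_eq hw ?_
    simp only [wop_mul, wop_ws, wop_wp]
    refine pi_refl_slidesAll p (reflAt_s i i₂ hi₂) ?_
    rw [hp]
    exact (reflAt_s i i₂ hi₂).transform (sigmaIdx_injective _) rfl rfl
      (sigmaSign_first_D i (by omega) (by omega))
      (by rw [one_mul]; exact sigmaSign_first_D i₂ (by omega) (by omega)) one_ne_zero
  | pi_last_s_D he q hq i j hi hi' hj =>
    refine wop_eq hw ?_
    simp only [wop_mul, wop_ws, wop_wp]
    exact pi_last_slidesAll q hq i j hi' hj
  | pi_one_swap_D he p hp m k hm hk =>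
    refine wop_eq hw ?_
    simp only [wop_mul, wop_ws, wop_wp]
    refine pi_refl_slidesAll p (reflAt_s m k (by omega)) ?_
    rw [hp]
    have hs : sigmaSign .D .first k = -1 := if_pos (Or.inr hk)
    exact (reflAt_last m k hm hk).transform (sigmaIdx_injective _) rfl rfl
      (sigmaSign_first_D m (by omega) (by omega)) (by rw [one_mul]; exact hs) one_ne_zero
  | pi_last_swap_D he q hq i m hi hm =>
    refine wop_eq hw ?_
    simp only [wop_mul, wop_ws, wop_wp]
    exact pi_last_slidesAll q hq i m (by omega) (by omega)

end Relations

/-! ### Linear independence of the standard monomials -/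

section Independence

variable {X : WeylType} {n : ℕ} {u v : ℂ} {hn : 2 ≤ n}

theorem of_pi_pow_four (p : OStar X n) : (PresentedGroup.of (.pi p) : We X n) ^ 4 = 1 := by
  have hp : ∀ k, wordMk (wp p ^ k) = (PresentedGroup.of (.pi p) : We X n) ^ k := fun k => by
    rw [map_pow]; rfl
  have h2 : GroupRel n X (wp p ^ 2) 1 → (PresentedGroup.of (.pi p) : We X n) ^ 4 = 1 := fun h => by
    have h' := wordMk_eq h
    rw [map_one, hp] at h'
    rw [show 4 = 2 * 2 from rfl, pow_mul, h', one_pow]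
  cases X with
  | B => exact h2 (.pi_sq_B p)
  | D =>
    rcases Nat.even_or_odd n with he | ho
    · exact h2 (.pi_sq_D he p)
    · have hq : p.1 = .last := p.2.resolve_right fun he => Nat.not_even_iff_odd.2 ho he
      have h' := wordMk_eq (GroupRel.pi_four_D ho p hq)
      rwa [map_one, hp] at h'

theorem gop_pi_pow_four (p : OStar X n) : gop X n u v hn (.pi p) ^ 4 = 1 :=
  pi_four p (by rw [map_pow]; exact of_pi_pow_four p)

/-- The induced module is a module over the double affine Hecke-Clifford algebra, once the relations of
`W^e` hold on it. The inverse of `π_r` acts as the third power of `π_r`, because `π_r ^ 4 = 1` in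
every case. -/
theorem rep_rel (hg : ∀ a b : FreeMonoid (GroupGen X n), GroupRel n X a b →
    wop X n u v hn a = wop X n u v hn b) {a b : Fr X n} (h : AlgRel n u v X a b) :
    rep X n u v hn a = rep X n u v hn b := by
  cases h with
  | group _ a b h => rw [rep_word, rep_word, hg a b h]
  | pi_piInv _ r => rw [map_mul, rep_pi, rep_piInv, ← pow_succ', gop_pi_pow_four, map_one]
  | piInv_pi _ r => rw [map_mul, rep_pi, rep_piInv, ← pow_succ, gop_pi_pow_four, map_one]
  | x_comm _ i j => rw [map_mul, map_mul, rep_x, rep_x, lx, lx, ← map_mul, PC.x_comm, map_mul]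
  | c_sq _ i => rw [map_mul, rep_c, lc, ← map_mul, PC.c_sq, map_one, map_one]
  | c_anti _ i j hij =>
    rw [map_neg, map_mul, map_mul, rep_c, rep_c, lc, lc, ← map_mul, PC.c_anti i j hij, map_neg,
      map_mul]
  | x_c_same _ i =>
    rw [map_neg, map_mul, map_mul, rep_x, rep_c, lx, lc, ← map_mul, PC.x_c_same, map_neg, map_mul]
  | x_c _ i j hij =>
    rw [map_mul, map_mul, rep_x, rep_c, lx, lc, ← map_mul, PC.x_c i j hij, map_mul]
  | s_c _ i j hij k =>
    have hr := reflAt_s (X := X) (u := u) (v := v) (hn := hn) i j hij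
    have h1 := hr.refl
    rw [one_smul, one_smul] at h1
    rw [map_mul, map_mul, rep_s, rep_c, rep_c]
    rcases eq_or_eq_or_ne k i j with rfl | rfl | ⟨hi, hj⟩
    · rw [Equiv.swap_apply_left, h1.ac]
    · rw [Equiv.swap_apply_right, h1.ad]
    · rw [Equiv.swap_apply_of_ne_of_ne hi hj, hr.comm_c k hi hj]
  | x_s _ i j hij =>
    have h1 := (reflAt_s (X := X) (u := u) (v := v) (hn := hn) i j hij).refl
    rw [one_smul, one_smul] at h1
    simp only [map_sub, map_mul, map_smul, map_one, rep_x, rep_s, rep_c]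
    rw [h1.ax, sub_sub_cancel]
  | x_s_other _ i j hij k hi hj =>
    rw [map_mul, map_mul, rep_s, rep_x, (reflAt_s i j hij).comm_x k hi hj]
  | sn_cn_B k hk => rw [map_neg, map_mul, map_mul, rep_s, rep_c, (signAt_last k hk).sign.bc]
  | sn_c_B i k hk hi => rw [map_mul, map_mul, rep_s, rep_c, (signAt_last k hk).comm_c i hi]
  | sn_xn_B k hk =>
    rw [map_sub, map_neg, map_mul, map_mul, rep_s, rep_x, (signAt_last k hk).sign.bx,
      AlgHom.commutes, Algebra.algebraMap_eq_smul_one]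
  | sn_x_B i k hk hi => rw [map_mul, map_mul, rep_s, rep_x, (signAt_last k hk).comm_x i hi]
  | sn_cn_D m k hm hk =>
    have h1 := (reflAt_last (u := u) (v := v) (hn := hn) m k hm hk).refl.ad
    rw [neg_one_smul, mul_neg, neg_eq_iff_eq_neg] at h1
    rw [map_neg, map_mul, map_mul, rep_s, rep_c, rep_c, h1]
  | sn_c_D i m k hm hk him hik =>
    rw [map_mul, map_mul, rep_s, rep_c, (reflAt_last m k hm hk).comm_c i him hik]
  | sn_xn_D m k hm hk =>
    have h1 := (reflAt_last (u := u) (v := v) (hn := hn) m k hm hk).refl.ay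
    rw [neg_one_smul, neg_one_smul, mul_neg, mul_neg, sub_neg_eq_add, neg_eq_iff_eq_neg, neg_add']
      at h1
    simp only [map_sub, map_neg, map_mul, map_smul, map_add, map_one, rep_s, rep_x, rep_c]
    rw [h1]
  | sn_x_D i m k hm hk him hik =>
    rw [map_mul, map_mul, rep_s, rep_x, (reflAt_last m k hm hk).comm_x i him hik]
  | pi_x _ r i => rw [map_mul, map_mul, map_smul, rep_pi, rep_x, rep_x, pi_mul_lx, sx]
  | pi_c _ r i => rw [map_mul, map_mul, map_smul, rep_pi, rep_c, rep_c, pi_mul_lc, sc]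

theorem we_of (g : GroupGen X n) : H.we X n u v (PresentedGroup.of g) = H.unitOf X n u v g :=
  congrArg Units.val (PresentedGroup.toGroup.of _)

/-- The standard monomials are independent, since `x^α c^β w` sends `1 ⊗ 1` to `x^α c^β ⊗ w` in the
induced module. -/
theorem linearIndependent_pbw (hg : ∀ a b : FreeMonoid (GroupGen X n), GroupRel n X a b →
    wop X n u v hn a = wop X n u v hn b) : LinearIndependent ℂ (H.pbw X n u v) := by
  let f : H X n u v →ₐ[ℂ] Module.End ℂ (Ind (We X n) n) :=
    RingQuot.liftAlgHom ℂ ⟨rep X n u v hn, fun _ _ h => rep_rel hg h⟩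
  have hf : ∀ a, f (H.mk X n u v a) = rep X n u v hn a := fun a =>
    RingQuot.liftAlgHom_mkAlgHom_apply ℂ _ _ a
  have hgen : ∀ (g : GroupGen X n) (w : We X n),
      f (H.unitOf X n u v g) (single w 1) = single (PresentedGroup.of g * w) 1 := by
    intro g w
    rw [← gop_single_one (u := u) (v := v) (hn := hn)]
    cases g with
    | s i => exact congrArg (· (single w 1)) ((hf _).trans (rep_s i))
    | pi r => exact congrArg (· (single w 1)) ((hf _).trans (rep_pi r))
  have hwe : ∀ w w' : We X n, f (H.we X n u v w) (single w' 1) = single (w * w') 1 := by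
    intro w
    induction w using PresentedGroup.induction_on with
    | _ z =>
    induction z using FreeGroup.induction_on with
    | C1 => intro w'; rw [map_one, map_one, map_one, Module.End.one_apply, one_mul]
    | of g => intro w'; exact (congrArg (fun y => f y (single w' 1)) (we_of g)).trans (hgen g w')
    | inv_of g _ =>
      intro w'
      have h1 := hgen g ((PresentedGroup.of g)⁻¹ * w')
      rw [mul_inv_cancel_left] at h1
      have h2 : H.we X n u v (PresentedGroup.mk (relators X n) (FreeGroup.of g)⁻¹)
          = ((H.unitOf X n u v g)⁻¹ : (H X n u v)ˣ) :=
        congrArg Units.val ((map_inv (H.weUnits X n u v) (PresentedGroup.of g)).trans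
          (congrArg _ (Units.ext (we_of g))))
      rw [h2, ← h1, ← Module.End.mul_apply, ← map_mul, Units.inv_mul, map_one,
        Module.End.one_apply]
      rfl
    | mul a b ha hb =>
      intro w'
      rw [map_mul, map_mul, map_mul, Module.End.mul_apply, hb, ha, mul_assoc]
  have hli := (linearIndependent_single (G := We X n) (linearIndependent_mono (n := n))).comp
    (fun t : (Fin n → ℕ) × (Fin n → ZMod 2) × We X n => ⟨t.2.2, t.1, t.2.1⟩) (by
      rintro ⟨a, b, w⟩ ⟨a', b', w'⟩ h
      simp only [Sigma.mk.injEq, heq_eq_eq, Prod.mk.injEq] at h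
      simp [h.1, h.2.1, h.2.2])
  refine LinearIndependent.of_comp ((LinearMap.applyₗ (R := ℂ) (single (1 : We X n) 1)).comp
    f.toLinearMap) ?_
  convert hli using 1
  funext t
  have hx : f (H.xPow X n u v t.1) = L (ordMono x t.1) := by
    rw [map_ordMono L]
    exact (map_ordMono f (H.x X n u v) t.1).trans (congrArg (fun y => ordMono y t.1)
      (funext fun i => (hf _).trans (rep_x i)))
  have hc : f (H.cPow X n u v t.2.1) = L (ordMono c fun i => (t.2.1 i).val) := by
    rw [map_ordMono L]
    exact (map_ordMono f (H.c X n u v) _).trans (congrArg (fun y => ordMono y _)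
      (funext fun i => (hf _).trans (rep_c i)))
  change f (H.xPow X n u v t.1 * H.cPow X n u v t.2.1 * H.we X n u v t.2.2) (single 1 1) = _
  rw [map_mul, map_mul, hx, hc, Module.End.mul_apply, hwe, ← map_mul, L_single, mul_one, mul_one]
  rfl

end Independence

/-! ### The standard monomials span -/

/-- The relation moving a reflection past its first letter implies the one for the second letter. -/
theorem IsRefl.of_ax {R : Type*} [Ring R] [Algebra ℂ R] {u : ℂ} {a x y c d : R} (h2 : a * a = 1)
    (anti : c * d = -(d * c)) (ax : a * x = y * a - u • (1 - d * c)) (ac : a * c = d * a)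
    (ad : a * d = c * a) : IsRefl u a x y c d where
  anti := anti
  ax := ax
  ay := by
    have h : y * a = a * x + u • (1 - d * c) := by rw [ax, sub_add_cancel]
    have e := mul_corr ac ad u
    rw [← mul_one (a * y), ← h2, ← mul_assoc (a * y), mul_assoc a y, h, mul_add, add_mul, e,
      ← mul_assoc, h2, one_mul, mul_assoc _ a a, h2, mul_one]
  ac := ac
  ad := ad

section Spanning

variable (X : WeylType) (n : ℕ) (u v : ℂ)

theorem H.satisfies : Satisfies (H.x X n u v) (H.c X n u v) where
  x_comm i j := H.x_comm X n u v i j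
  c_sq i := H.c_sq X n u v i
  c_anti i j h := H.c_anti X n u v i j h
  x_c_same i := by
    simpa [H.x, H.c] using H.mk_rel (AlgRel.x_c_same (u := u) (v := v) X i)
  x_c i j h := by
    simpa [H.x, H.c] using H.mk_rel (AlgRel.x_c (u := u) (v := v) X i j h)

/-- The homomorphism from the polynomial-Clifford algebra. -/
def pcHom : PC n →ₐ[ℂ] H X n u v := PC.lift (H.x X n u v) (H.c X n u v) (H.satisfies X n u v)

variable {X n u v}

@[simp] theorem pcHom_x (i : Fin n) : pcHom X n u v (PC.x i) = H.x X n u v i := PC.lift_x _ _ _ i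

@[simp] theorem pcHom_c (i : Fin n) : pcHom X n u v (PC.c i) = H.c X n u v i := PC.lift_c _ _ _ i

/-- `g` can be moved to the right of the image of `a`, up to the image of the polynomial-Clifford
algebra. -/
def Passes (g : H X n u v) (a : PC n) : Prop :=
  ∃ a' a'', g * pcHom X n u v a = pcHom X n u v a' * g + pcHom X n u v a''

/-- The elements past which `g` can be moved form a subalgebra. -/
theorem passes_of_generators {g : H X n u v} (hx : ∀ i, Passes g (PC.x i))
    (hc : ∀ i, Passes g (PC.c i)) (a : PC n) : Passes g a := by
  have hmul : ∀ a b, Passes g a → Passes g b → Passes g (a * b) := by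
    rintro a b ⟨a', a'', ha⟩ ⟨b', b'', hb⟩
    refine ⟨a' * b', a' * b'' + a'' * b, ?_⟩
    rw [map_mul, ← mul_assoc, ha, add_mul, mul_assoc, hb, mul_add, ← mul_assoc, map_add, map_mul,
      map_mul, map_mul, add_assoc]
  induction a using induction_left with
  | one => exact ⟨1, 0, by simp⟩
  | add a b ha hb =>
    obtain ⟨a', a'', ha⟩ := ha
    obtain ⟨b', b'', hb⟩ := hb
    refine ⟨a' + b', a'' + b'', ?_⟩
    rw [map_add, mul_add, ha, hb, map_add, map_add, add_mul, add_add_add_comm]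
  | smul r a ha =>
    obtain ⟨a', a'', ha⟩ := ha
    refine ⟨r • a', r • a'', ?_⟩
    rw [map_smul, mul_smul_comm, ha, map_smul, map_smul, smul_add, smul_mul_assoc]
  | x_mul i a ha => exact hmul _ _ (hx i) ha
  | c_mul i a ha => exact hmul _ _ (hc i) ha

variable (X n u v) in
/-- The span of the standard monomials. -/
def spanPbw : Submodule ℂ (H X n u v) := Submodule.span ℂ (Set.range (H.pbw X n u v))

theorem pcHom_mono_mul_we (t : (Fin n → ℕ) × (Fin n → ZMod 2)) (w : We X n) :
    pcHom X n u v (mono t) * H.we X n u v w = H.pbw X n u v (t.1, t.2, w) := by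
  have h1 : pcHom X n u v (ordMono x t.1) = H.xPow X n u v t.1 :=
    (map_ordMono _ _ _).trans (congrArg (fun y => ordMono y t.1) (funext pcHom_x))
  have h2 : pcHom X n u v (ordMono c fun i => (t.2 i).val) = H.cPow X n u v t.2 :=
    (map_ordMono _ _ _).trans (congrArg (fun y => ordMono y _) (funext pcHom_c))
  rw [mono, map_mul, h1, h2]
  rfl

theorem pcHom_mul_we_mem (a : PC n) (w : We X n) :
    pcHom X n u v a * H.we X n u v w ∈ spanPbw X n u v := by
  have ha : a ∈ Submodule.span ℂ (Set.range (mono (n := n))) := by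
    rw [span_mono]; exact Submodule.mem_top
  induction ha using Submodule.span_induction with
  | mem a ha =>
    obtain ⟨t, rfl⟩ := ha
    exact Submodule.subset_span ⟨(t.1, t.2, w), (pcHom_mono_mul_we t w).symm⟩
  | zero => rw [map_zero, zero_mul]; exact zero_mem _
  | add a b _ _ ha hb => rw [map_add, add_mul]; exact add_mem ha hb
  | smul r a _ ha => rw [map_smul, smul_mul_assoc]; exact Submodule.smul_mem _ _ ha

theorem mul_mem_spanPbw {g : H X n u v}
    (h : ∀ a w, g * (pcHom X n u v a * H.we X n u v w) ∈ spanPbw X n u v) {m : H X n u v}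
    (hm : m ∈ spanPbw X n u v) : g * m ∈ spanPbw X n u v := by
  induction hm using Submodule.span_induction with
  | mem m hm =>
    obtain ⟨t, rfl⟩ := hm
    have h1 := h (mono (t.1, t.2.1)) t.2.2
    rwa [pcHom_mono_mul_we] at h1
  | zero => rw [mul_zero]; exact zero_mem _
  | add a b _ _ ha hb => rw [mul_add]; exact add_mem ha hb
  | smul r a _ ha => rw [mul_smul_comm]; exact Submodule.smul_mem _ _ ha

theorem unitOf_mul_mem {g : GroupGen X n}
    (hx : ∀ i, Passes (H.unitOf X n u v g : H X n u v) (PC.x i))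
    (hc : ∀ i, Passes (H.unitOf X n u v g : H X n u v) (PC.c i)) {m : H X n u v}
    (hm : m ∈ spanPbw X n u v) : (H.unitOf X n u v g : H X n u v) * m ∈ spanPbw X n u v := by
  refine mul_mem_spanPbw (fun a w => ?_) hm
  obtain ⟨a', a'', h⟩ := passes_of_generators hx hc a
  rw [← mul_assoc, h, add_mul, mul_assoc, ← we_of, ← map_mul]
  exact add_mem (pcHom_mul_we_mem _ _) (pcHom_mul_we_mem _ _)

/-- `neg_mul` with the ring fixed, so that rewriting need not search for its structure. -/
theorem neg_mul_H (a b : H X n u v) : -a * b = -(a * b) := neg_mul a b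

/-- `mul_neg` with the ring fixed, so that rewriting need not search for its structure. -/
theorem mul_neg_H (a b : H X n u v) : a * -b = -(a * b) := mul_neg a b

theorem s_sq (i : Fin n) :
    H.mk X n u v (Fr.s i) * H.mk X n u v (Fr.s i) = 1 :=
  (H.unitOf X n u v (.s i)).val_inv

theorem passes_s_lt (i j : Fin n) (hij : lab j = lab i + 1) (k : Fin n) :
    Passes (H.mk X n u v (Fr.s i)) (PC.x k) ∧ Passes (H.mk X n u v (Fr.s i)) (PC.c k) := by
  have hne : i ≠ j := by rintro rfl; omega
  have hsc : ∀ k, H.mk X n u v (Fr.s i) * H.c X n u v k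
      = H.c X n u v (Equiv.swap i j k) * H.mk X n u v (Fr.s i) := fun k => by
    simpa [H.c] using H.mk_rel (AlgRel.s_c (u := u) (v := v) X i j hij k)
  have hxs : H.x X n u v j * H.mk X n u v (Fr.s i) - H.mk X n u v (Fr.s i) * H.x X n u v i
      = u • (1 - H.c X n u v j * H.c X n u v i) := by
    simpa [H.c, H.x] using H.mk_rel (AlgRel.x_s (u := u) (v := v) X i j hij)
  have hr : IsRefl u (H.mk X n u v (Fr.s i)) (H.x X n u v i) (H.x X n u v j) (H.c X n u v i)
      (H.c X n u v j) :=
    .of_ax (s_sq i) (H.c_anti X n u v i j hne) (by rw [← hxs, sub_sub_cancel])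
      (by rw [hsc, Equiv.swap_apply_left]) (by rw [hsc, Equiv.swap_apply_right])
  refine ⟨?_, PC.c (Equiv.swap i j k), 0, by simp [hsc]⟩
  rcases eq_or_eq_or_ne k i j with rfl | rfl | ⟨hki, hkj⟩
  · exact ⟨PC.x j, -(u • (1 - PC.c j * PC.c k)), by
      simp only [map_neg, map_smul, map_sub, map_mul, map_one, pcHom_x, pcHom_c]
      rw [hr.ax, sub_eq_add_neg]⟩
  · exact ⟨PC.x i, u • (1 - PC.c i * PC.c k), by
      simp only [map_smul, map_sub, map_mul, map_one, pcHom_x, pcHom_c]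
      rw [hr.ay]⟩
  · have h := H.mk_rel (AlgRel.x_s_other (u := u) (v := v) X i j hij k hki hkj)
    exact ⟨PC.x k, 0, by simpa [H.x] using h.symm⟩

theorem passes_s_last_B (k : Fin n) (hk : lab k = n) (i : Fin n) :
    Passes (H.mk .B n u v (Fr.s k)) (PC.x i) ∧ Passes (H.mk .B n u v (Fr.s k)) (PC.c i) := by
  by_cases hi : i = k
  · subst hi
    have h1 := H.mk_rel (AlgRel.sn_xn_B (u := u) (v := v) i hk)
    have h2 := H.mk_rel (AlgRel.sn_cn_B (u := u) (v := v) i hk)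
    rw [map_sub, map_neg, map_mul, map_mul, AlgHom.commutes, sub_eq_add_neg] at h1
    rw [map_neg, map_mul, map_mul] at h2
    refine ⟨⟨-PC.x i, -algebraMap ℂ _ ((Real.sqrt 2 : ℂ) * v), ?_⟩, -PC.c i, 0, ?_⟩
    · rw [map_neg, map_neg, AlgHom.commutes, pcHom_x, neg_mul_H]; exact h1
    · rw [map_neg, map_zero, add_zero, pcHom_c, neg_mul_H]; exact h2
  · have h1 := H.mk_rel (AlgRel.sn_x_B (u := u) (v := v) i k hk hi)
    have h2 := H.mk_rel (AlgRel.sn_c_B (u := u) (v := v) i k hk hi)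
    exact ⟨⟨PC.x i, 0, by simpa [H.x] using h1⟩, PC.c i, 0, by simpa [H.c] using h2⟩

theorem passes_s_last_D (m k : Fin n) (hm : lab m + 1 = n) (hk : lab k = n) (i : Fin n) :
    Passes (H.mk .D n u v (Fr.s k)) (PC.x i) ∧ Passes (H.mk .D n u v (Fr.s k)) (PC.c i) := by
  have hne : k ≠ m := by rintro rfl; omega
  have h1 : H.mk .D n u v (Fr.s k) * H.c .D n u v k
      = -H.c .D n u v m * H.mk .D n u v (Fr.s k) := by
    rw [neg_mul_H]
    simpa [H.c] using H.mk_rel (AlgRel.sn_cn_D (u := u) (v := v) m k hm hk)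
  have h2 : H.mk .D n u v (Fr.s k) * -H.c .D n u v m
      = H.c .D n u v k * H.mk .D n u v (Fr.s k) := by
    have hs := s_sq (X := .D) (u := u) (v := v) k
    generalize H.mk .D n u v (Fr.s k) = s at *
    rw [← mul_one (s * -H.c .D n u v m), ← hs, ← mul_assoc, mul_assoc s, ← h1, ← mul_assoc, hs,
      one_mul]
  have hr : IsRefl u (H.mk .D n u v (Fr.s k)) (H.x .D n u v k) (-H.x .D n u v m)
      (H.c .D n u v k) (-H.c .D n u v m) := by
    refine .of_ax (s_sq k) ?_ ?_ h1 h2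
    · rw [mul_neg_H, neg_mul_H, H.c_anti .D n u v k m hne]
    · rw [neg_mul_H, neg_mul_H, sub_neg_eq_add]
      simpa [H.c, H.x] using H.mk_rel (AlgRel.sn_xn_D (u := u) (v := v) m k hm hk)
  rcases eq_or_eq_or_ne i k m with rfl | rfl | ⟨hik, him⟩
  · refine ⟨⟨-PC.x m, -(u • (1 - -PC.c m * PC.c i)), ?_⟩, -PC.c m, 0, ?_⟩
    · simp only [map_neg, map_smul, map_sub, map_mul, map_one, pcHom_x, pcHom_c]
      rw [hr.ax, sub_eq_add_neg]
    · rw [map_neg, map_zero, add_zero, pcHom_c, pcHom_c, hr.ac]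
  · refine ⟨⟨-PC.x k, -(u • (1 - PC.c k * -PC.c i)), ?_⟩, -PC.c k, 0, ?_⟩
    · simp only [map_neg, map_smul, map_sub, map_mul, map_one, pcHom_x, pcHom_c]
      have h := congrArg Neg.neg hr.ay
      rw [mul_neg_H, neg_neg, neg_add] at h
      rw [h, neg_mul_H]
    · have h := congrArg Neg.neg hr.ad
      rw [mul_neg_H, neg_neg] at h
      rw [map_neg, map_zero, add_zero, pcHom_c, pcHom_c, h, neg_mul_H]
  · have h1 := H.mk_rel (AlgRel.sn_x_D (u := u) (v := v) i m k hm hk him hik)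
    have h2 := H.mk_rel (AlgRel.sn_c_D (u := u) (v := v) i m k hm hk him hik)
    exact ⟨⟨PC.x i, 0, by simpa [H.x] using h1⟩, PC.c i, 0, by simpa [H.c] using h2⟩

theorem passes_pi (r : OStar X n) (i : Fin n) :
    Passes (H.mk X n u v (Fr.pi r)) (PC.x i) ∧ Passes (H.mk X n u v (Fr.pi r)) (PC.c i) := by
  have h1 := H.mk_rel (AlgRel.pi_x (u := u) (v := v) X r i)
  have h2 := H.mk_rel (AlgRel.pi_c (u := u) (v := v) X r i)
  exact ⟨⟨sigmaSign X r.1 i • PC.x (sigmaIdx r.1 i), 0, by simpa [H.x] using h1⟩,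
    sigmaSign X r.1 i • PC.c (sigmaIdx r.1 i), 0, by simpa [H.c] using h2⟩

/-- The span of the standard monomials contains `1` and is stable under left multiplication by all
generators. -/
theorem span_pbw (hn : 2 ≤ n) : Submodule.span ℂ (Set.range (H.pbw X n u v)) = ⊤ := by
  have hs : ∀ (i : Fin n) (m : H X n u v), m ∈ spanPbw X n u v →
      H.mk X n u v (Fr.s i) * m ∈ spanPbw X n u v := by
    intro i m hm
    have hp : ∀ k, Passes (H.mk X n u v (Fr.s i)) (PC.x k) ∧
        Passes (H.mk X n u v (Fr.s i)) (PC.c k) := by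
      intro k
      by_cases hi : lab i < n
      · obtain ⟨j, hj⟩ := exists_lab_succ i hi
        exact passes_s_lt i j hj k
      · have hi' : lab i = n := le_antisymm (lab_le i) (not_lt.1 hi)
        cases X with
        | B => exact passes_s_last_B i hi' k
        | D =>
          obtain ⟨m, hm⟩ := exists_lab_pred i (by omega)
          exact passes_s_last_D m i (hm.trans hi') hi' k
    exact unitOf_mul_mem (g := .s i) (fun k => (hp k).1) (fun k => (hp k).2) hm
  have hpi : ∀ (r : OStar X n) (m : H X n u v), m ∈ spanPbw X n u v →
      H.mk X n u v (Fr.pi r) * m ∈ spanPbw X n u v := fun r m hm =>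
    unitOf_mul_mem (g := .pi r) (fun k => (passes_pi r k).1) (fun k => (passes_pi r k).2) hm
  have hinv : ∀ r : OStar X n, H.mk X n u v (Fr.piInv r) = H.mk X n u v (Fr.pi r) ^ 3 := fun r => by
    have h1 : H.weUnits X n u v (PresentedGroup.of (.pi r)) = H.unitOf X n u v (.pi r) :=
      PresentedGroup.toGroup.of _
    have h4 : H.unitOf X n u v (.pi r) ^ 4 = 1 := by
      rw [← h1, ← map_pow, of_pi_pow_four, map_one]
    have h5 : (H.unitOf X n u v (.pi r))⁻¹ = H.unitOf X n u v (.pi r) ^ 3 :=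
      inv_eq_of_mul_eq_one_right (by rw [← pow_succ', h4])
    exact congrArg Units.val h5
  refine eq_top_iff.2 fun a _ => ?_
  obtain ⟨f, rfl⟩ := RingQuot.mkAlgHom_surjective ℂ (AlgRel n u v X) a
  change H.mk X n u v f ∈ spanPbw X n u v
  suffices h : ∀ m ∈ spanPbw X n u v, H.mk X n u v f * m ∈ spanPbw X n u v by
    have h1 := pcHom_mul_we_mem (u := u) (v := v) (1 : PC n) (1 : We X n)
    rw [map_one, map_one, mul_one] at h1
    simpa using h 1 h1
  induction f using FreeAlgebra.induction with
  | grade0 r =>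
    intro m hm
    rw [AlgHom.commutes, ← Algebra.smul_def]
    exact Submodule.smul_mem _ _ hm
  | grade1 g =>
    intro m hm
    cases g with
    | s i => exact hs i m hm
    | pi r => exact hpi r m hm
    | piInv r =>
      have h3 : H.mk X n u v (FreeAlgebra.ι ℂ (.piInv r)) * m = H.mk X n u v (Fr.pi r) *
          (H.mk X n u v (Fr.pi r) * (H.mk X n u v (Fr.pi r) * m)) := by
        refine (congrArg (· * m) (hinv r)).trans ?_
        simp only [pow_succ, pow_zero, one_mul, mul_assoc]
      rw [h3]
      exact hpi r _ (hpi r _ (hpi r _ hm))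
    | x i =>
      refine mul_mem_spanPbw (fun a w => ?_) hm
      have h := pcHom_mul_we_mem (u := u) (v := v) (PC.x i * a) w
      rw [map_mul, pcHom_x, mul_assoc] at h
      exact h
    | c i =>
      refine mul_mem_spanPbw (fun a w => ?_) hm
      have h := pcHom_mul_we_mem (u := u) (v := v) (PC.c i * a) w
      rw [map_mul, pcHom_c, mul_assoc] at h
      exact h
  | mul f g hf hg => intro m hm; rw [map_mul, mul_assoc]; exact hf trivial _ (hg trivial _ hm)
  | add f g hf hg => intro m hm; rw [map_add, add_mul]; exact add_mem (hf trivial _ hm) (hg trivial _ hm)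

end Spanning

/-! ### The multiplication map -/

section MulMap

variable {n : ℕ}

/-- The generator `c_i` of the Clifford algebra. -/
def clGen (i : Fin n) : Cl n := CliffordAlgebra.ι (stdForm n) (Pi.single i 1)

theorem clGen_sq (i : Fin n) : clGen i * clGen i = (1 : Cl n) := by
  rw [clGen, CliffordAlgebra.ι_sq_scalar]
  simp [QuadraticMap.weightedSumSquares_apply, Pi.single_apply]

theorem clGen_anti (i j : Fin n) (h : i ≠ j) : clGen i * clGen j = -(clGen j * clGen i : Cl n) := by
  refine CliffordAlgebra.ι_mul_ι_comm_of_isOrtho ?_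
  rw [QuadraticMap.isOrtho_def]
  simp only [QuadraticMap.weightedSumSquares_apply, one_smul, Pi.add_apply, add_mul, mul_add,
    Finset.sum_add_distrib]
  simp [Pi.single_apply, h, h.symm]

theorem ι_eq_sum (z : Fin n → ℂ) :
    CliffordAlgebra.ι (stdForm n) z = ∑ i, z i • clGen i := by
  conv_lhs => rw [← Finset.univ_sum_single z]
  rw [map_sum]
  refine Finset.sum_congr rfl fun i _ => ?_
  rw [clGen, ← map_smul, ← Pi.single_smul, smul_eq_mul, mul_one]

theorem span_clGen :
    Submodule.span ℂ (Set.range fun β : Fin n → ZMod 2 =>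
      ordMono (clGen (n := n)) fun i => (β i).val) = ⊤ := by
  set S := Submodule.span ℂ (Set.range fun β : Fin n → ZMod 2 =>
      ordMono (clGen (n := n)) fun i => (β i).val)
  have hmem : ∀ β : Fin n → ZMod 2, ordMono (clGen (n := n)) (fun i => (β i).val) ∈ S := fun β =>
    Submodule.subset_span ⟨β, rfl⟩
  have hgen : ∀ i, ∀ a ∈ S, clGen i * a ∈ S := by
    intro i a ha
    induction ha using Submodule.span_induction with
    | mem a ha =>
      obtain ⟨β, rfl⟩ := ha
      rcases mul_ordMono_val clGen clGen_sq clGen_anti i β with h | h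
      · exact h ▸ hmem _
      · exact h ▸ neg_mem (hmem _)
    | zero => rw [mul_zero]; exact zero_mem _
    | add a b _ _ ha hb => rw [mul_add]; exact add_mem ha hb
    | smul r a _ ha => rw [mul_smul_comm]; exact Submodule.smul_mem _ _ ha
  refine eq_top_iff.2 fun a _ => ?_
  induction a using CliffordAlgebra.left_induction with
  | algebraMap r =>
    rw [Algebra.algebraMap_eq_smul_one]
    refine Submodule.smul_mem _ _ ?_
    have h := hmem 0
    simp only [Pi.zero_apply, ZMod.val_zero] at h
    rwa [show (fun _ : Fin n => 0) = (0 : Fin n → ℕ) from rfl, ordMono_zero] at h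
  | add a b ha hb => exact add_mem (ha trivial) (hb trivial)
  | ι_mul a z ha =>
    rw [ι_eq_sum, Finset.sum_mul]
    refine Submodule.sum_mem _ fun i _ => ?_
    rw [smul_mul_assoc]
    exact Submodule.smul_mem _ _ (hgen i a (ha trivial))

theorem span_image2_tmul {V W : Type*} [AddCommMonoid V] [Module ℂ V] [AddCommMonoid W] [Module ℂ W]
    {ι κ : Type*} {f : ι → V} {g : κ → W} (hf : Submodule.span ℂ (Set.range f) = ⊤)
    (hg : Submodule.span ℂ (Set.range g) = ⊤) :
    Submodule.span ℂ (Set.range fun p : ι × κ => f p.1 ⊗ₜ[ℂ] g p.2) = ⊤ := by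
  have h := Submodule.map₂_span_span (R := ℂ) (TensorProduct.mk ℂ V W) (Set.range f) (Set.range g)
  rw [hf, hg, TensorProduct.map₂_mk_top_top_eq_top] at h
  rw [h]
  congr 1
  ext z
  simp [Set.mem_image2]

/-- A linear map sending a spanning family to a linearly independent spanning family is
bijective. -/
theorem bijective_of_linearIndependent {V W ι : Type*} [AddCommMonoid V] [Module ℂ V]
    [AddCommMonoid W] [Module ℂ W] {f : V →ₗ[ℂ] W} {b : ι → V}
    (hb : Submodule.span ℂ (Set.range b) = ⊤) (hli : LinearIndependent ℂ (f ∘ b))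
    (hsp : Submodule.span ℂ (Set.range (f ∘ b)) = ⊤) : Function.Bijective f := by
  have hsurj : Function.Surjective (Finsupp.linearCombination ℂ b) := by
    rw [← LinearMap.range_eq_top, Finsupp.range_linearCombination, hb]
  have hcomp : ∀ l, f (Finsupp.linearCombination ℂ b l) = Finsupp.linearCombination ℂ (f ∘ b) l :=
    fun l => Finsupp.apply_linearCombination ℂ f b l
  refine ⟨fun x y hxy => ?_, ?_⟩
  · obtain ⟨l, rfl⟩ := hsurj x
    obtain ⟨l', rfl⟩ := hsurj y
    rw [hcomp, hcomp] at hxy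
    rw [hli hxy]
  · rwa [Set.range_comp, ← Submodule.map_span, hb, Submodule.map_top, LinearMap.range_eq_top] at hsp

variable (X : WeylType) (u v : ℂ)

/-- The tensors `x^α ⊗ c^β ⊗ w`. -/
def tensorMono (p : ((Fin n →₀ ℕ) × (Fin n → ZMod 2)) × We X n) :
    (MvPolynomial (Fin n) ℂ ⊗[ℂ] Cl n) ⊗[ℂ] MonoidAlgebra ℂ (We X n) :=
  (MvPolynomial.monomial p.1.1 1 ⊗ₜ ordMono clGen fun i => (p.1.2 i).val) ⊗ₜ
    MonoidAlgebra.of ℂ (We X n) p.2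

theorem span_tensorMono : Submodule.span ℂ (Set.range (tensorMono (n := n) X)) = ⊤ := by
  have h1 : Submodule.span ℂ (Set.range fun α : Fin n →₀ ℕ =>
      (MvPolynomial.monomial α 1 : MvPolynomial (Fin n) ℂ)) = ⊤ := by
    have := (MvPolynomial.basisMonomials (Fin n) ℂ).span_eq
    rwa [MvPolynomial.coe_basisMonomials] at this
  have h2 : Submodule.span ℂ (Set.range (MonoidAlgebra.of ℂ (We X n))) = ⊤ := by
    refine eq_top_iff.2 fun a _ => ?_
    induction a using MonoidAlgebra.induction_on with
    | of w => exact Submodule.subset_span ⟨w, rfl⟩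
    | add a b ha hb => exact add_mem (ha trivial) (hb trivial)
    | smul r a ha => exact Submodule.smul_mem _ _ (ha trivial)
  exact span_image2_tmul
    (f := fun q : (Fin n →₀ ℕ) × (Fin n → ZMod 2) =>
      (MvPolynomial.monomial q.1 1 : MvPolynomial (Fin n) ℂ) ⊗ₜ[ℂ]
        ordMono (clGen (n := n)) fun i => (q.2 i).val)
    (g := fun w : We X n => MonoidAlgebra.of ℂ (We X n) w)
    (span_image2_tmul (f := fun α : Fin n →₀ ℕ => (MvPolynomial.monomial α 1 :
      MvPolynomial (Fin n) ℂ)) (g := fun β : Fin n → ZMod 2 =>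
        ordMono (clGen (n := n)) fun i => (β i).val) h1 span_clGen) h2

/-- Multiplication sends the standard tensors to the standard monomials. -/
theorem mulMap_tensorMono (p : ((Fin n →₀ ℕ) × (Fin n → ZMod 2)) × We X n) :
    H.mulMap X n u v (tensorMono X p) = H.pbw X n u v (p.1.1, p.1.2, p.2) := by
  have h1 : H.polyHom X n u v (MvPolynomial.monomial p.1.1 1) = H.xPow X n u v p.1.1 := by
    refine (AddMonoidAlgebra.lift_single _ _ _).trans ?_
    rw [one_smul]; rfl
  have h2 : H.cliffHom X n u v (ordMono clGen fun i => (p.1.2 i).val) = H.cPow X n u v p.1.2 := by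
    refine (map_ordMono _ _ _).trans (congrArg (fun y => ordMono y _) (funext fun i => ?_))
    rw [clGen, H.cliffHom, CliffordAlgebra.lift_ι_apply]
    simp [H.cLin, Fintype.linearCombination_apply, Pi.single_apply]
  have h3 : H.weHom X n u v (MonoidAlgebra.of ℂ (We X n) p.2) = H.we X n u v p.2 :=
    MonoidAlgebra.lift_of _ _
  rw [tensorMono, H.mulMap, H.pbw, LinearMap.comp_apply, TensorProduct.map_tmul,
    LinearMap.comp_apply, TensorProduct.map_tmul, LinearMap.mul'_apply, LinearMap.mul'_apply]
  exact congrArg₂ (· * ·) (congrArg₂ (· * ·) h1 h2) h3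

theorem pbwProperty (hn : 2 ≤ n) (hg : ∀ a b : FreeMonoid (GroupGen X n), GroupRel n X a b →
    wop X n u v hn a = wop X n u v hn b) : PBWProperty X n u v := by
  have hli := linearIndependent_pbw (u := u) (v := v) hg
  have hsp := span_pbw (X := X) (u := u) (v := v) hn
  let e : ((Fin n →₀ ℕ) × (Fin n → ZMod 2)) × We X n ≃ (Fin n → ℕ) × (Fin n → ZMod 2) × We X n :=
    (Equiv.prodAssoc _ _ _).trans (Finsupp.equivFunOnFinite.prodCongr (Equiv.refl _))
  have he : H.mulMap X n u v ∘ tensorMono X = H.pbw X n u v ∘ e :=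
    funext fun p => mulMap_tensorMono X u v p
  refine ⟨⟨hli, hsp⟩, bijective_of_linearIndependent
    (span_tensorMono X) ?_ ?_⟩
  · rw [he]; exact hli.comp e e.injective
  · rw [he, e.surjective.range_comp]; exact hsp

end MulMap

end DAHCa

end

/-- PBW theorem for the trigonometric double affine Hecke-Clifford algebras of types `B_n` and `D_n`
(in type `D` the parameter `v` does not occur in the relations). -/
theorem mainTheorem2 :
    (∀ n : ℕ, 2 ≤ n → ∀ u v : ℂ, DAHCa.PBWProperty .B n u v) ∧
    (∀ n : ℕ, 4 ≤ n → ∀ u v : ℂ, DAHCa.PBWProperty .D n u v) :=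
  ⟨fun _ hn u v => DAHCa.pbwProperty .B u v hn fun _ _ h => DAHCa.wop_group_B h,
    fun _ hn u v => DAHCa.pbwProperty .D u v (by omega) fun _ _ h => DAHCa.wop_group_D hn h⟩
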